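/- Definitions. A graph $G$ on $n$ vertices is $(\epsilon,p)$-regular if every vertex has degree at least $(1-\epsilon)np$ and every two distinct vertices have at most $(1+\epsilon)np^2$ common neighbours. For a graph $T$, a $T$-factor of $G$ is a collection of vertex-disjoint (not necessarily induced) subgraphs of $G$, each isomorphic to $T$, that together cover all vertices of $G$. Two $T$-factors are edge-disjoint if no edge of $G$ belongs to both. Theorem. There is an absolute constant $\epsilon_0>0$ such that the following holds. Let $T$ be a tree with $t\ge 2$ vertices, and let $\epsilon=\epsilon(n)\in(0,\epsilon_0]$ and $p=p(n)>0$ be sequences of real numbers with $$\frac{\epsilon^6np^4}{\log^3 n}\longrightarrow\infty\qquad (n\to\infty).$$ Then there is an $n_0$ such that for every multiple $n\ge n_0$ of $t$, every $(\epsilon(n),p(n))$-regular graph $G$ on $n$ vertices contains a collection of pairwise edge-disjoint $T$-factors which covers all but at most a $2\epsilon(n)^{1/3}$-fraction of the edges of $G$. -/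

import Mathlib

/-- A finite graph `G` on `n` vertices is `(ε, p)`-regular if every degree is at least
`(1 - ε) n p` and any two distinct vertices have at most `(1 + ε) n p²` common neighbours. -/
structure IsPseudoRegular {V : Type*} [Fintype V] (G : SimpleGraph V) (ε p : ℝ) : Prop where
  le_degree : ∀ v : V,
    (1 - ε) * (Fintype.card V : ℝ) * p ≤ ((G.neighborSet v).ncard : ℝ)
  codegree_le : ∀ u v : V, u ≠ v →
    ((G.commonNeighbors u v).ncard : ℝ) ≤ (1 + ε) * (Fintype.card V : ℝ) * p ^ 2

/-- An `H`-factor of `G`: a collection of vertex-disjoint (not necessarily induced) subgraphs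
of `G`, each isomorphic to `H`, which together cover all vertices of `G`. -/
structure IsFactor {W V : Type*} (H : SimpleGraph W) (G : SimpleGraph V)
    (F : Set G.Subgraph) : Prop where
  iso : ∀ K ∈ F, Nonempty (K.coe ≃g H)
  disjoint : ∀ K ∈ F, ∀ L ∈ F, K ≠ L → Disjoint K.verts L.verts
  cover : ∀ v : V, ∃ K ∈ F, v ∈ K.verts

/-- The set of all edges of the members of a collection of subgraphs of `G`. -/
def factorEdges {V : Type*} {G : SimpleGraph V} (F : Set G.Subgraph) : Set (Sym2 V) :=
  ⋃ K ∈ F, K.edgeSet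

/-- `G` contains a (finite) collection of pairwise edge-disjoint `H`-factors which leaves at most
a `δ`-fraction of the edges of `G` uncovered. -/
def HasFactorPacking {W V : Type*} (H : SimpleGraph W) (G : SimpleGraph V) (δ : ℝ) : Prop :=
  ∃ (k : ℕ) (F : Fin k → Set G.Subgraph),
    (∀ i, IsFactor H G (F i)) ∧
    (∀ i j, i ≠ j → Disjoint (factorEdges (F i)) (factorEdges (F j))) ∧
    ((G.edgeSet \ ⋃ i, factorEdges (F i)).ncard : ℝ) ≤ δ * (G.edgeSet.ncard : ℝ)

/-! Write `n = m * t` and split the vertices once into `m` groups of size `t`. A cyclic shift of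
every group gives an equipartition into `t` classes of size exactly `m`, indexed by the vertices of
the tree, with one vertex of each group in each class. Take `r` such partitions with independent
random shifts. By Chernoff's bound all degrees and codegrees into a class are about `m * p` and at
most about `m * p ^ 2`, and each pair from distinct groups lies between adjacent classes in about `K
= 2 * r * (t - 1) / t ^ 2` of the partitions (`exists_shifts`).

Now give each edge to a random one of the partitions in which it joins adjacent classes
(`exists_edge_assignment`). For each partition and each edge of the tree, the assigned edges form a
bipartite graph on `m + m` vertices which is pseudorandom of density `q = p / K`: its degrees are at
least about `m * q`, its codegrees at most about `m * q ^ 2`.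

A second moment computation controls the edges between two sets, which verifies the condition of the
bipartite `k`-factor theorem for `k` close to `m * q`. The factor decomposes into perfect matchings
(`exists_disjoint_perms`). Since a tree has no cycles, one perfect matching per tree edge always
closes up to `m` disjoint copies of the tree, that is, a factor (`exists_factor`).

This uses about `r * (t - 1) * m * (m * q) = n ^ 2 * p / 2` edges. The codegree condition also
bounds the number of edges of the graph by about this amount, so only a small fraction remains. The
loss is of order `√ε`, which is below `2 * ε ^ (1 / 3)` for small `ε`. -/

namespace TreeFactor
open Finset
open scoped Classical
-- Independent choices and Chernoff bounds
/-- The average of a real function over a finite set. -/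
noncomputable def avg {Ω : Type*} (S : Finset Ω) (F : Ω → ℝ) : ℝ := (∑ ω ∈ S, F ω) / #S

/-- The probability of an event for the uniform distribution on a finite set. -/
noncomputable def prob {Ω : Type*} (S : Finset Ω) (P : Ω → Prop) : ℝ := #{ω ∈ S | P ω} / #S

lemma prob_eq_avg {Ω : Type*} (S : Finset Ω) (P : Ω → Prop) [DecidablePred P] :
    prob S P = avg S (fun ω => if P ω then 1 else 0) := by
  simp only [prob, avg, sum_boole]
  congr!

lemma prob_nonneg {Ω : Type*} (S : Finset Ω) (P : Ω → Prop) : 0 ≤ prob S P := by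
  unfold prob; positivity

lemma avg_one {Ω : Type*} {S : Finset Ω} (hS : S.Nonempty) : avg S (fun _ => 1) = 1 := by
  have : (#S : ℝ) ≠ 0 := by exact_mod_cast hS.card_pos.ne'
  simp [avg, this]

lemma avg_add_mul {Ω : Type*} (S : Finset Ω) (F G : Ω → ℝ) (c : ℝ) :
    avg S (fun ω => F ω + c * G ω) = avg S F + c * avg S G := by
  simp [avg, sum_add_distrib, ← mul_sum]; ring

section Independence

variable {ι α : Type*} [Fintype ι]

/-- The choice functions of a family of finite sets. -/
noncomputable def choices (L : ι → Finset α) : Finset (ι → α) := Fintype.piFinset L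

lemma choices_nonempty {L : ι → Finset α} (hL : ∀ i, (L i).Nonempty) : (choices L).Nonempty :=
  Fintype.piFinset_nonempty.2 hL

/-- Functions of disjoint blocks of coordinates are uncorrelated. -/
lemma avg_mul (L : ι → Finset α) {F G : (ι → α) → ℝ} {B C : Set ι}
    (hF : DependsOn F B) (hG : DependsOn G C) (h : Disjoint B C) :
    avg (choices L) (fun ω => F ω * G ω)
      = avg (choices L) F * avg (choices L) G := by
  set Ω := choices L with hΩ
  rcases Ω.eq_empty_or_nonempty with h0 | h0
  · simp [avg, h0]
  have hc : (#Ω : ℝ) ≠ 0 := by exact_mod_cast h0.card_pos.ne'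
  have key : (∑ ω ∈ Ω, F ω) * (∑ ω ∈ Ω, G ω) = #Ω * ∑ ω ∈ Ω, F ω * G ω := by
    -- Exchanging the `B`-coordinates of two samples is an involution of pairs. It turns `F x * G y`
    -- into a product evaluated at a single sample, because `F` sees only the `B`-coordinates and
    -- `G` only the others.
    let mix : (ι → α) × (ι → α) → (ι → α) × (ι → α) := fun p =>
      (fun i => if i ∈ B then p.1 i else p.2 i, fun i => if i ∈ B then p.2 i else p.1 i)
    have hmix : ∀ p, mix (mix p) = p := by
      rintro ⟨x, y⟩
      ext i <;> by_cases hi : i ∈ B <;> simp [mix, hi]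
    have hmem : ∀ p ∈ Ω ×ˢ Ω, mix p ∈ Ω ×ˢ Ω := by
      rintro ⟨x, y⟩ hp
      simp only [mem_product, hΩ, choices, Fintype.mem_piFinset, mix] at hp ⊢
      constructor <;> intro i <;> split_ifs <;> simp [hp.1 i, hp.2 i]
    have e1 : (∑ ω ∈ Ω, F ω) * (∑ ω ∈ Ω, G ω) = ∑ p ∈ Ω ×ˢ Ω, F p.1 * G p.2 := by
      rw [sum_mul_sum, sum_product]
    have e2 : ∑ p ∈ Ω ×ˢ Ω, F p.1 * G p.2 = ∑ p ∈ Ω ×ˢ Ω, F p.1 * G p.1 := by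
      refine sum_nbij' mix mix hmem hmem (fun p _ => hmix p) (fun p _ => hmix p) ?_
      rintro ⟨x, y⟩ -
      have h1 : F (mix (x, y)).1 = F x := hF fun i hi => by simp [mix, hi]
      have h2 : G (mix (x, y)).1 = G y := hG fun i hi => by
        have : i ∉ B := fun hB => Set.disjoint_left.1 h hB hi
        simp [mix, this]
      rw [h1, h2]
    rw [e1, e2, sum_product]
    simp [mul_sum]
  have : (∑ ω ∈ Ω, F ω * G ω) = (∑ ω ∈ Ω, F ω) * (∑ ω ∈ Ω, G ω) / #Ω := by
    rw [key]; field_simp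
  simp only [avg, this]; field_simp

lemma prob_and (L : ι → Finset α) {P Q : (ι → α) → Prop} {B C : Set ι}
    (hP : DependsOn P B) (hQ : DependsOn Q C) (h : Disjoint B C) :
    prob (choices L) (fun ω => P ω ∧ Q ω)
      = prob (choices L) P * prob (choices L) Q := by
  rw [prob_eq_avg, prob_eq_avg, prob_eq_avg, ← avg_mul L (B := B) (C := C) _ _ h]
  · congr 1; ext ω; by_cases h1 : P ω <;> by_cases h2 : Q ω <;> simp [h1, h2]
  · intro x y hxy; simp [hP hxy]
  · intro x y hxy; simp [hQ hxy]

lemma prob_eq_inv (L : ι → Finset α) (hL : ∀ i, (L i).Nonempty) (i : ι) {a : α} (ha : a ∈ L i) :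
    prob (choices L) (fun ω => ω i = a) = (#(L i) : ℝ)⁻¹ := by
  have h1 := Fintype.card_filter_piFinset_eq_of_mem L i ha
  have h2 : #(choices L) = #(L i) * ∏ j ∈ univ.erase i, #(L j) := by
    rw [choices, Fintype.card_piFinset, ← mul_prod_erase univ (fun j => #(L j)) (mem_univ i)]
  have h3 : ∏ j ∈ univ.erase i, (#(L j) : ℝ) ≠ 0 :=
    prod_ne_zero_iff.2 fun j _ => by exact_mod_cast (hL j).card_pos.ne'
  have h4 : (#(L i) : ℝ) ≠ 0 := by exact_mod_cast (hL i).card_pos.ne'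
  have h1' : (#{ω ∈ choices L | ω i = a} : ℝ) = ∏ j ∈ univ.erase i, (#(L j) : ℝ) := by
    rw [← Nat.cast_prod, ← h1, choices]
  unfold prob
  rw [h1', h2]; push_cast; field_simp

lemma avg_prod {W : Type*} (L : ι → Finset α) (hL : ∀ i, (L i).Nonempty) (S : Finset W)
    (F : W → (ι → α) → ℝ) (B : W → Set ι) (hF : ∀ w ∈ S, DependsOn (F w) (B w))
    (hB : ∀ w ∈ S, ∀ w' ∈ S, w ≠ w' → Disjoint (B w) (B w')) :
    avg (choices L) (fun ω => ∏ w ∈ S, F w ω)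
      = ∏ w ∈ S, avg (choices L) (F w) := by
  induction S using Finset.induction_on with
  | empty =>
    simpa using avg_one (choices_nonempty hL)
  | insert w S hw ih =>
    have := ih (fun v hv => hF v (mem_insert_of_mem hv))
      (fun v hv v' hv' => hB v (mem_insert_of_mem hv) v' (mem_insert_of_mem hv'))
    rw [prod_insert hw, ← this, ← avg_mul L (hF w (mem_insert_self _ _))
      (C := ⋃ v ∈ S, B v)]
    · congr 1; ext ω; rw [prod_insert hw]
    · intro x y hxy
      refine prod_congr rfl fun v hv => hF v (mem_insert_of_mem hv) fun i hi => hxy i ?_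
      exact Set.mem_biUnion (s := (S : Set W)) hv hi
    · rw [Set.disjoint_iUnion₂_right]
      intro v hv
      exact hB w (mem_insert_self _ _) v (mem_insert_of_mem hv) (fun h => hw (h ▸ hv))

/-- Exponential moments of the number of events which occur, for independent events. -/
lemma avg_exp_le {W : Type*} (L : ι → Finset α) (hL : ∀ i, (L i).Nonempty) (S : Finset W)
    (P : W → (ι → α) → Prop) [∀ w ω, Decidable (P w ω)] (B : W → Set ι) (hP : ∀ w ∈ S, DependsOn (P w) (B w))
    (hB : ∀ w ∈ S, ∀ w' ∈ S, w ≠ w' → Disjoint (B w) (B w')) {l : ℝ} (hl : |l| ≤ 1) :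
    avg (choices L) (fun ω => Real.exp (l * #{w ∈ S | P w ω}))
      ≤ Real.exp ((l + l ^ 2) * ∑ w ∈ S, prob (choices L) (P w)) := by
  have h1 : ∀ ω : ι → α, Real.exp (l * #{w ∈ S | P w ω})
      = ∏ w ∈ S, (1 + (Real.exp l - 1) * if P w ω then 1 else 0) := by
    intro ω
    have : (#{w ∈ S | P w ω} : ℝ) = ∑ w ∈ S, if P w ω then 1 else 0 := by simp
    rw [this, mul_sum, Real.exp_sum]
    refine prod_congr rfl fun w _ => ?_
    split_ifs <;> simp
  simp_rw [h1]
  rw [avg_prod L hL S (fun w ω => 1 + (Real.exp l - 1) * if P w ω then 1 else 0) B _ hB,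
    mul_sum, Real.exp_sum]
  · refine prod_le_prod ?_ ?_
    · intro w _
      unfold avg
      refine div_nonneg (sum_nonneg fun ω _ => ?_) (by positivity)
      split_ifs
      · simp [Real.exp_nonneg]
      · simp
    · intro w _
      rw [avg_add_mul, avg_one (choices_nonempty hL), ← prob_eq_avg]
      -- For `|l| ≤ 1` each factor is `1 + (exp l - 1) * P ≤ exp ((l + l ^ 2) * P)`.
      have h3 : Real.exp l - 1 ≤ l + l ^ 2 := by
        have := (abs_le.1 (Real.abs_exp_sub_one_sub_id_le hl)).2
        linarith
      have h4 := mul_le_mul_of_nonneg_right h3 (prob_nonneg (choices L) (P w))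
      linarith [Real.add_one_le_exp ((l + l ^ 2) * prob (choices L) (P w))]
  · intro w hw x y hxy
    simp [hP w hw hxy]

/-- The exponential form of Markov's inequality: on the event, `exp (F - c)` is at least `1`. -/
lemma prob_le_exp_mul_avg {Ω : Type*} (S : Finset Ω) (P : Ω → Prop) (F : Ω → ℝ) (c : ℝ)
    (h : ∀ ω ∈ S, P ω → c ≤ F ω) :
    prob S P ≤ Real.exp (-c) * avg S (fun ω => Real.exp (F ω)) := by
  unfold prob avg
  rw [← mul_div_assoc]
  refine div_le_div_of_nonneg_right ?_ (by positivity)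
  rw [mul_sum]
  have : (#{ω ∈ S | P ω} : ℝ) = ∑ ω ∈ S, if P ω then 1 else 0 := by simp
  rw [this]
  refine sum_le_sum fun ω hω => ?_
  rw [← Real.exp_add]
  split_ifs with hp
  · exact Real.one_le_exp (by linarith [h ω hω hp])
  · positivity

/-- Chernoff's bound for the upper tail. -/
lemma prob_upper_tail {W : Type*} (L : ι → Finset α) (hL : ∀ i, (L i).Nonempty) (S : Finset W)
    (P : W → (ι → α) → Prop) [∀ w ω, Decidable (P w ω)] (B : W → Set ι) (hP : ∀ w ∈ S, DependsOn (P w) (B w))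
    (hB : ∀ w ∈ S, ∀ w' ∈ S, w ≠ w' → Disjoint (B w) (B w')) {η M : ℝ} (h0 : 0 ≤ η) (h1 : η ≤ 1)
    (hM : ∑ w ∈ S, prob (choices L) (P w) ≤ M) :
    prob (choices L) (fun ω => (1 + η) * M < #{w ∈ S | P w ω})
      ≤ Real.exp (-(η ^ 2 * M / 4)) := by
  -- With `l = η / 2` the exponent is `-(η / 2) * (1 + η) * M + (η / 2 + η ^ 2 / 4) * M = -η ^ 2 * M
  -- / 4`. The lower tail takes `l = -(η / 2)` and gives the same value.
  have hl : |η / 2| ≤ 1 := by rw [abs_of_nonneg (by linarith)]; linarith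
  refine (prob_le_exp_mul_avg _ _ (fun ω => η / 2 * #{w ∈ S | P w ω}) (η / 2 * ((1 + η) * M))
    fun ω _ h => mul_le_mul_of_nonneg_left h.le (by linarith)).trans ?_
  refine (mul_le_mul_of_nonneg_left (avg_exp_le L hL S P B hP hB hl) (Real.exp_nonneg _)).trans ?_
  rw [← Real.exp_add, Real.exp_le_exp]
  nlinarith [mul_le_mul_of_nonneg_left hM (show 0 ≤ η / 2 + (η / 2) ^ 2 by positivity)]

/-- Chernoff's bound for the lower tail. -/
lemma prob_lower_tail {W : Type*} (L : ι → Finset α) (hL : ∀ i, (L i).Nonempty) (S : Finset W)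
    (P : W → (ι → α) → Prop) [∀ w ω, Decidable (P w ω)] (B : W → Set ι) (hP : ∀ w ∈ S, DependsOn (P w) (B w))
    (hB : ∀ w ∈ S, ∀ w' ∈ S, w ≠ w' → Disjoint (B w) (B w')) {η M : ℝ} (h0 : 0 ≤ η) (h1 : η ≤ 1)
    (hM : M ≤ ∑ w ∈ S, prob (choices L) (P w)) :
    prob (choices L) (fun ω => (#{w ∈ S | P w ω} : ℝ) < (1 - η) * M)
      ≤ Real.exp (-(η ^ 2 * M / 4)) := by
  have hl : |-(η / 2)| ≤ 1 := by rw [abs_neg, abs_of_nonneg (by linarith)]; linarith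
  refine (prob_le_exp_mul_avg _ _ (fun ω => -(η / 2) * #{w ∈ S | P w ω})
    (-(η / 2) * ((1 - η) * M)) fun ω _ h => ?_).trans ?_
  · nlinarith
  refine (mul_le_mul_of_nonneg_left (avg_exp_le L hL S P B hP hB hl) (Real.exp_nonneg _)).trans ?_
  rw [← Real.exp_add, Real.exp_le_exp]
  nlinarith [mul_le_mul_of_nonneg_left hM (show 0 ≤ η / 2 - (η / 2) ^ 2 by nlinarith)]

end Independence

/-- The union bound. -/
lemma exists_forall_not_of_sum_prob_lt {Ω K : Type*} (S : Finset Ω) (hS : S.Nonempty)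
    (I : Finset K) (P : K → Ω → Prop) {b : ℝ} (hP : ∀ k ∈ I, prob S (P k) ≤ b)
    (hb : #I * b < 1) : ∃ ω ∈ S, ∀ k ∈ I, ¬ P k ω := by
  by_contra! hcon
  have hc : (0 : ℝ) < #S := by exact_mod_cast hS.card_pos
  have h1 : #S ≤ ∑ k ∈ I, #{ω ∈ S | P k ω} := by
    calc #S ≤ #(I.biUnion fun k => {ω ∈ S | P k ω}) := card_le_card fun ω hω => by
          obtain ⟨k, hk, h⟩ := hcon ω hω
          simp only [mem_biUnion, mem_filter]
          exact ⟨k, hk, hω, h⟩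
      _ ≤ _ := card_biUnion_le
  have h2 : (#S : ℝ) ≤ ∑ k ∈ I, b * #S := by
    calc (#S : ℝ) ≤ ∑ k ∈ I, (#{ω ∈ S | P k ω} : ℝ) := by exact_mod_cast h1
      _ ≤ _ := sum_le_sum fun k hk => (div_le_iff₀ hc).1 (hP k hk)
  rw [sum_const, nsmul_eq_mul] at h2
  nlinarith

/-! ### Bipartite factors and perfect matchings -/

section Matching

variable {A : Type*} [Fintype A]

/-- A regular bipartite graph of positive degree has a perfect matching. -/
lemma exists_perm_of_regular (R : A → A → Prop) {k : ℕ} (hk : 0 < k)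
    (h1 : ∀ a, #{b | R a b} = k) (h2 : ∀ b, #{a | R a b} = k) :
    ∃ σ : Equiv.Perm A, ∀ a, R a (σ a) := by
  -- Hall's condition: `X` sends out `k * #X` edges, all into its neighbourhood `N`, which can
  -- absorb at most `k * #N`.
  obtain ⟨f, hf, hR⟩ := (Finset.all_card_le_biUnion_card_iff_exists_injective
    (fun a : A => ({b | R a b} : Finset A))).1 (by
      intro X
      set N := X.biUnion fun a => ({b | R a b} : Finset A)
      have e1 : ∑ a ∈ X, #{b ∈ N | R a b} = #X * k := by
        rw [← smul_eq_mul, ← sum_const]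
        refine sum_congr rfl fun a ha => ?_
        rw [← h1 a]
        congr 1
        ext b
        simp only [mem_filter, mem_univ, true_and, and_iff_right_iff_imp]
        intro hab
        exact mem_biUnion.2 ⟨a, ha, by simpa using hab⟩
      have e2 : ∑ b ∈ N, #{a ∈ X | R a b} ≤ #N * k := by
        rw [← smul_eq_mul, ← sum_const]
        refine sum_le_sum fun b _ => ?_
        rw [← h2 b]
        exact card_le_card (filter_subset_filter _ (subset_univ _))
      have e3 : ∑ a ∈ X, #{b ∈ N | R a b} = ∑ b ∈ N, #{a ∈ X | R a b} :=
        sum_card_bipartiteAbove_eq_sum_card_bipartiteBelow R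
      exact Nat.le_of_mul_le_mul_right (by omega) hk)
  refine ⟨Equiv.ofBijective f (Finite.injective_iff_bijective.1 hf), fun a => ?_⟩
  simpa using hR a

/-- A regular bipartite graph decomposes into perfect matchings. -/
lemma exists_perms_of_regular (k : ℕ) (R : A → A → Prop)
    (h1 : ∀ a, #{b | R a b} = k) (h2 : ∀ b, #{a | R a b} = k) :
    ∃ σ : Fin k → Equiv.Perm A, (∀ i a, R a (σ i a)) ∧ ∀ i j a, i ≠ j → σ i a ≠ σ j a := by
  induction k generalizing R with
  | zero => exact ⟨fun i => i.elim0, fun i => i.elim0, fun i => i.elim0⟩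
  | succ k ih =>
    obtain ⟨τ, hτ⟩ := exists_perm_of_regular R k.succ_pos h1 h2
    obtain ⟨σ, hσ, hd⟩ := ih (fun a b => R a b ∧ b ≠ τ a)
      (fun a => by
        have : ({b | R a b ∧ b ≠ τ a} : Finset A) = ({b | R a b} : Finset A).erase (τ a) := by
          ext b; simp [and_comm]
        have h := congrArg card this
        rw [card_erase_of_mem (by simpa using hτ a), h1, Nat.add_sub_cancel] at h
        convert h)
      (fun b => by
        have : ({a | R a b ∧ b ≠ τ a} : Finset A) = ({a | R a b} : Finset A).erase (τ.symm b) := by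
          ext a
          simp only [mem_filter, mem_univ, true_and, mem_erase, ne_eq, Equiv.eq_symm_apply]
          rw [and_comm, eq_comm]
        have h := congrArg card this
        rw [card_erase_of_mem (by simpa using hτ (τ.symm b)), h2, Nat.add_sub_cancel] at h
        convert h)
    refine ⟨Fin.cons τ σ, fun i a => ?_, fun i j a hij => ?_⟩
    · refine Fin.cases ?_ (fun i => ?_) i
      · simpa using hτ a
      · simpa using (hσ i a).1
    · revert hij
      refine Fin.cases ?_ (fun i => ?_) i <;> refine Fin.cases ?_ (fun j => ?_) j
      · simp
      · intro _; simpa using (hσ j a).2.symm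
      · intro _; simpa using (hσ i a).2
      · intro hij; simpa using hd i j a (fun h => hij (by rw [h]))

/-- The bipartite factor theorem: a bipartite graph with equal sides has a `k`-factor as soon as
every `X` and `Z` span at least `k (|X| + |Z| - |A|)` edges. -/
lemma exists_regular_subrelation (R : A → A → Prop) (k : ℕ)
    (h : ∀ X Z : Finset A, k * (#X + #Z) ≤ k * Fintype.card A + ∑ a ∈ X, #{b ∈ Z | R a b}) :
    ∃ K : A → A → Prop, (∀ a b, K a b → R a b) ∧ (∀ a, #{b | K a b} = k) ∧
      ∀ b, #{a | K a b} = k := by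
  set dl : A → ℕ := fun a => #{b | R a b} with hdl
  set dr : A → ℕ := fun b => #{a | R a b} with hdr
  -- The condition for a singleton against everything says that all degrees are at least `k`, so the
  -- truncated differences `dl a - k` and `dr b - k` below are true ones.
  have hdlk : ∀ a, k ≤ dl a := fun a => by
    have := h {a} univ
    simp only [card_singleton, sum_singleton, card_univ] at this
    simp only [hdl]; nlinarith
  have hdrk : ∀ b, k ≤ dr b := fun b => by
    have := h univ {b}
    rw [show ∑ a, #{b' ∈ ({b} : Finset A) | R a b'} = ∑ b' ∈ {b}, #{a | R a b'} from
      sum_card_bipartiteAbove_eq_sum_card_bipartiteBelow R] at this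
    simp only [card_singleton, sum_singleton, card_univ] at this
    simp only [hdr]; nlinarith
  -- The factor is found as a perfect matching of an auxiliary graph. Both sides contain a copy of
  -- every edge; the target side also has `dl a - k` clones of each left vertex, the source side `dr
  -- b - k` clones of each right vertex. A source edge goes to its own copy (kept) or to a clone of
  -- its left end (deleted); a clone of `b` takes the target copy of an edge at `b`.
  let E := {e : A × A // R e.1 e.2}
  let CL := Σ a, Fin (dl a - k)
  let CR := Σ b, Fin (dr b - k)
  let edgesL : A → Finset E := fun a => {e | e.1.1 = a}
  let edgesR : A → Finset E := fun b => {e | e.1.2 = b}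
  let t : E ⊕ CR → Finset (E ⊕ CL) := fun x => {y | x.elim
    (fun e => y = Sum.inl e ∨ ∃ s, y = Sum.inr ⟨e.1.1, s⟩)
    (fun c => ∃ e : E, e.1.2 = c.1 ∧ y = Sum.inl e)}
  have htl : ∀ e y, y ∈ t (Sum.inl e) ↔ y = Sum.inl e ∨ ∃ s, y = Sum.inr ⟨e.1.1, s⟩ :=
    fun e y => mem_filter.trans (and_iff_right (mem_univ _))
  have htr : ∀ c y, y ∈ t (Sum.inr c) ↔ ∃ e : E, e.1.2 = c.1 ∧ y = Sum.inl e :=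
    fun c y => mem_filter.trans (and_iff_right (mem_univ _))
  have hEL : ∀ a, #(edgesL a) = dl a := fun a => by
    refine card_bij' (fun e _ => e.1.2)
      (fun b hb => ⟨(a, b), by simpa using hb⟩) ?_ ?_ ?_ ?_
    · rintro ⟨⟨x, y⟩, hxy⟩ he
      simp only [edgesL, mem_filter, mem_univ, true_and] at he
      subst he; simpa using hxy
    · intro b hb; simp [edgesL]
    · rintro ⟨⟨x, y⟩, hxy⟩ he
      simp only [edgesL, mem_filter, mem_univ, true_and] at he
      subst he; rfl
    · intro b hb; rfl
  have hER : ∀ b, #(edgesR b) = dr b := fun b => by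
    refine card_bij' (fun e _ => e.1.1)
      (fun a ha => ⟨(a, b), by simpa using ha⟩) ?_ ?_ ?_ ?_
    · rintro ⟨⟨x, y⟩, hxy⟩ he
      simp only [edgesR, mem_filter, mem_univ, true_and] at he
      subst he; simpa using hxy
    · intro b hb; simp [edgesR]
    · rintro ⟨⟨x, y⟩, hxy⟩ he
      simp only [edgesR, mem_filter, mem_univ, true_and] at he
      subst he; rfl
    · intro b hb; rfl
  have hEX : ∀ X : Finset A, #{e : E | e.1.1 ∈ X} = ∑ a ∈ X, dl a := fun X => by
    rw [card_eq_sum_card_fiberwise (f := fun e : E => e.1.1) (t := X) (by intro e; simp)]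
    refine sum_congr rfl fun a ha => ?_
    rw [← hEL a]
    congr 1
    ext e
    simp only [edgesL, mem_filter, mem_univ, true_and, and_iff_right_iff_imp]
    rintro rfl; exact ha
  have hEY : ∀ Y : Finset A, #{e : E | e.1.2 ∈ Y} = ∑ b ∈ Y, dr b := fun Y => by
    rw [card_eq_sum_card_fiberwise (f := fun e : E => e.1.2) (t := Y) (by intro e; simp)]
    refine sum_congr rfl fun a ha => ?_
    rw [← hER a]
    congr 1
    ext e
    simp only [edgesR, mem_filter, mem_univ, true_and, and_iff_right_iff_imp]
    rintro rfl; exact ha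
  have hEXY : ∀ X Y : Finset A, #{e : E | e.1.1 ∈ X ∧ e.1.2 ∈ Y} ≤ ∑ a ∈ X, #{b ∈ Y | R a b} :=
    fun X Y => by
      rw [card_eq_sum_card_fiberwise (f := fun e : E => e.1.1) (t := X) (by intro e; simp; tauto)]
      refine sum_le_sum fun a ha => ?_
      refine card_le_card_of_injOn (fun e => e.1.2) ?_ ?_
      · rintro ⟨⟨x, y⟩, hxy⟩ he
        simp only [coe_filter, mem_filter, mem_univ, true_and, Set.mem_ofPred_eq] at he ⊢
        obtain ⟨⟨h1, h2⟩, rfl⟩ := he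
        exact ⟨h2, hxy⟩
      · rintro ⟨⟨x, y⟩, hxy⟩ he ⟨⟨x', y'⟩, hxy'⟩ he' hee
        simp only [coe_filter, mem_filter, mem_univ, true_and, Set.mem_ofPred_eq] at he he' hee
        simp [he.2, he'.2, hee]
  have hsplit : ∀ X Y : Finset A,
      ∑ a ∈ X, dl a = ∑ a ∈ X, #{b ∈ Y | R a b} + ∑ a ∈ X, #{b ∈ Yᶜ | R a b} := fun X Y => by
    rw [← sum_add_distrib]
    refine sum_congr rfl fun a _ => ?_
    rw [← card_union_of_disjoint]
    · rw [← filter_union, union_compl]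
    · exact disjoint_filter_filter disjoint_compl_right
  -- In Hall's condition for `S`, let `X` be the left ends of the edges in `S` and `Y` the right
  -- vertices with a clone in `S`. The neighbours are the edges in `S` or at `Y`, and all clones of
  -- `X`. An edge of `S` at `Y` runs between `X` and `Y`, so after cancellation what is needed is
  -- the hypothesis for `X` and the complement of `Y`.
  obtain ⟨f, hf, hft⟩ := (Finset.all_card_le_biUnion_card_iff_exists_injective t).1 (by
    intro S
    set X : Finset A := S.toLeft.image fun e => e.1.1
    set Y : Finset A := S.toRight.image fun c => c.1
    have c1 : #S.toLeft + #S.toRight = #S := card_toLeft_add_card_toRight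
    have c2 : #S.toRight ≤ ∑ b ∈ Y, (dr b - k) := by
      calc #S.toRight ≤ #(Y.sigma fun b => (univ : Finset (Fin (dr b - k)))) :=
            card_le_card fun c hc => mem_sigma.2 ⟨mem_image_of_mem _ hc, mem_univ _⟩
        _ = _ := by simp
    have c3 : ∑ b ∈ Y, (dr b - k) + k * #Y = ∑ b ∈ Y, dr b := by
      rw [mul_comm, ← smul_eq_mul, ← sum_const, ← sum_add_distrib]
      exact sum_congr rfl fun b _ => Nat.sub_add_cancel (hdrk b)
    have c4 : ∑ a ∈ X, (dl a - k) + k * #X = ∑ a ∈ X, dl a := by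
      rw [mul_comm, ← smul_eq_mul, ← sum_const, ← sum_add_distrib]
      exact sum_congr rfl fun b _ => Nat.sub_add_cancel (hdlk b)
    set EY : Finset E := {e : E | e.1.2 ∈ Y} with hEYdef
    have c5 : #(S.toLeft ∪ EY) + ∑ a ∈ X, (dl a - k) ≤ #(S.biUnion t) := by
      calc _ = #((S.toLeft ∪ EY).disjSum (X.sigma fun a => (univ : Finset (Fin (dl a - k))))) := by
            rw [card_disjSum]; simp
        _ ≤ _ := card_le_card fun y hy => by
            rw [mem_biUnion]
            rcases y with e | ⟨a, s⟩
            · rw [inl_mem_disjSum, mem_union] at hy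
              rcases hy with he | he
              · exact ⟨Sum.inl e, by simpa using he, (htl _ _).2 (Or.inl rfl)⟩
              · simp only [hEYdef, mem_filter, mem_univ, true_and, Y, mem_image] at he
                obtain ⟨c, hc, hce⟩ := he
                exact ⟨Sum.inr c, by simpa using hc, (htr _ _).2 ⟨e, hce.symm, rfl⟩⟩
            · rw [inr_mem_disjSum, mem_sigma] at hy
              obtain ⟨e, he, hea⟩ := mem_image.1 hy.1
              refine ⟨Sum.inl e, by simpa using he, (htl _ _).2 ?_⟩
              simp only at hea
              subst hea
              exact Or.inr ⟨s, rfl⟩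
    have c6 : #S.toLeft + #(EY \ S.toLeft) = #(S.toLeft ∪ EY) := by
      rw [← union_sdiff_self_eq_union, card_union_of_disjoint disjoint_sdiff]
    have c7 : #EY ≤ #(EY \ S.toLeft) + ∑ a ∈ X, #{b ∈ Y | R a b} := by
      refine le_trans ?_ (Nat.add_le_add_left (hEXY X Y) _)
      refine le_trans (card_le_card fun e he => ?_) (card_union_le _ _)
      rw [mem_union, mem_sdiff]
      by_cases h1 : e ∈ S.toLeft
      · right
        simp only [mem_filter, mem_univ, true_and]
        exact ⟨mem_image_of_mem (fun e : E => e.1.1) h1, by simpa [hEYdef] using he⟩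
      · exact Or.inl ⟨he, h1⟩
    have c8 : #EY = _ := hEY Y
    have c9 := hsplit X Y
    have c10 := h X Yᶜ
    have c11 : k * #Y + k * #Yᶜ = k * Fintype.card A := by
      rw [← mul_add, card_add_card_compl]
    rw [mul_add] at c10
    omega)
  have hcard : Fintype.card (E ⊕ CR) = Fintype.card (E ⊕ CL) := by
    have e1 := hEX univ
    have e2 := hEY univ
    simp only [mem_univ, filter_true, card_univ] at e1 e2
    have e3 : ∑ b, (dr b - k) + k * Fintype.card A = ∑ b, dr b := by
      rw [mul_comm, ← smul_eq_mul, ← card_univ, ← sum_const, ← sum_add_distrib]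
      exact sum_congr rfl fun b _ => Nat.sub_add_cancel (hdrk b)
    have e4 : ∑ b, (dl b - k) + k * Fintype.card A = ∑ b, dl b := by
      rw [mul_comm, ← smul_eq_mul, ← card_univ, ← sum_const, ← sum_add_distrib]
      exact sum_congr rfl fun b _ => Nat.sub_add_cancel (hdlk b)
    have e5 : Fintype.card CR = ∑ b, (dr b - k) := by simp [CR]
    have e6 : Fintype.card CL = ∑ b, (dl b - k) := by simp [CL]
    rw [Fintype.card_sum, Fintype.card_sum]
    omega
  have hbij : Function.Bijective f := (Fintype.bijective_iff_injective_and_card f).2 ⟨hf, hcard⟩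
  have hfl : ∀ e, f (Sum.inl e) = Sum.inl e ∨ ∃ s, f (Sum.inl e) = Sum.inr ⟨e.1.1, s⟩ :=
    fun e => (htl _ _).1 (hft (Sum.inl e))
  have hfr : ∀ c : CR, ∃ e : E, e.1.2 = c.1 ∧ f (Sum.inr c) = Sum.inl e :=
    fun c => (htr _ _).1 (hft (Sum.inr c))
  -- All clones are used since `f` is bijective. Those of `a` can only be hit by edges at `a`, so
  -- exactly `dl a - k` edges at `a` are deleted.
  have hL : ∀ a, #{e ∈ edgesL a | f (Sum.inl e) ≠ Sum.inl e} = dl a - k := fun a => by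
    have hs : ∀ s : Fin (dl a - k), ∃ e : E, e.1.1 = a ∧ f (Sum.inl e) = Sum.inr ⟨a, s⟩ := by
      intro s
      obtain ⟨y, hy⟩ := hbij.2 (Sum.inr ⟨a, s⟩)
      rcases y with e | c
      · rcases hfl e with h' | ⟨s', h'⟩
        · rw [h'] at hy; simp at hy
        · have : e.1.1 = a := by
            rw [h'] at hy
            exact congrArg Sigma.fst (Sum.inr_injective hy)
          exact ⟨e, this, hy⟩
      · obtain ⟨e, -, h'⟩ := hfr c
        rw [h'] at hy; simp at hy
    choose g hg1 hg2 using hs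
    rw [← Fintype.card_fin (dl a - k), ← card_univ]
    symm
    refine card_bij (fun s _ => g s) ?_ ?_ ?_
    · intro s _
      simp [edgesL, hg1, hg2]
    · intro s _ s' _ hss
      have := (hg2 s).symm.trans ((congrArg (fun e => f (Sum.inl e)) hss).trans (hg2 s'))
      exact eq_of_heq (Sigma.mk.inj (Sum.inr_injective this)).2
    · intro e he
      simp only [edgesL, mem_filter, mem_univ, true_and] at he
      obtain ⟨rfl, hne⟩ := he
      obtain ⟨s, hs⟩ := (hfl e).resolve_left hne
      exact ⟨s, mem_univ _, Sum.inl_injective (hf ((hg2 s).trans hs.symm))⟩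
  -- The target copy of a deleted edge is not hit by the edge itself, hence by a clone of its right
  -- end. So the edges deleted at `b` correspond to the clones of `b`.
  have hR : ∀ b, #{e ∈ edgesR b | f (Sum.inl e) ≠ Sum.inl e} = dr b - k := fun b => by
    choose g hg1 hg2 using fun s : Fin (dr b - k) => hfr ⟨b, s⟩
    rw [← Fintype.card_fin (dr b - k), ← card_univ]
    symm
    refine card_bij (fun s _ => g s) ?_ ?_ ?_
    · intro s _
      simp only [edgesR, mem_filter, mem_univ, true_and]
      refine ⟨hg1 s, fun hh => ?_⟩
      have := hf (hh.trans (hg2 s).symm)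
      simp at this
    · intro s _ s' _ hss
      have := hf ((hg2 s).trans ((congrArg Sum.inl hss).trans (hg2 s').symm))
      exact eq_of_heq (Sigma.mk.inj (Sum.inr_injective this)).2
    · intro e he
      simp only [edgesR, mem_filter, mem_univ, true_and] at he
      obtain ⟨rfl, hne⟩ := he
      obtain ⟨y, hy⟩ := hbij.2 (Sum.inl e)
      rcases y with e' | ⟨b, s⟩
      · rcases hfl e' with h' | ⟨s', h'⟩
        · rw [h'] at hy
          rw [Sum.inl_injective hy] at h'
          exact absurd h' hne
        · rw [h'] at hy; simp at hy
      · obtain ⟨e'', h1, h2⟩ := hfr ⟨b, s⟩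
        rw [h2] at hy
        have := Sum.inl_injective hy
        subst this
        simp only at h1
        subst h1
        exact ⟨s, mem_univ _, Sum.inl_injective ((hg2 s).symm.trans h2)⟩
  refine ⟨fun a b => ∃ hab : R a b, f (Sum.inl ⟨(a, b), hab⟩) = Sum.inl ⟨(a, b), hab⟩,
    fun a b hab => hab.1, fun a => ?_, fun b => ?_⟩
  · have e1 := card_filter_add_card_filter_not (s := edgesL a) (fun e => f (Sum.inl e) = Sum.inl e)
    rw [hL, hEL] at e1
    have e2 : #{b | ∃ hab : R a b, f (Sum.inl ⟨(a, b), hab⟩) = Sum.inl ⟨(a, b), hab⟩}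
        = #{e ∈ edgesL a | f (Sum.inl e) = Sum.inl e} := by
      refine card_bij (fun b hb => ⟨(a, b), (mem_filter.1 hb).2.1⟩) ?_ ?_ ?_
      · intro b hb
        simpa [edgesL] using (mem_filter.1 hb).2.2
      · intro b hb b' hb' hbb
        exact congrArg (fun e : E => e.1.2) hbb
      · rintro ⟨⟨x, y⟩, hxy⟩ he
        simp only [edgesL, mem_filter, mem_univ, true_and] at he
        obtain ⟨rfl, he⟩ := he
        exact ⟨y, by simpa using ⟨hxy, he⟩, rfl⟩
    have := hdlk a
    have e3 : #{e ∈ edgesL a | f (Sum.inl e) = Sum.inl e} = k := by omega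
    convert e2.trans e3
  · have e1 := card_filter_add_card_filter_not (s := edgesR b) (fun e => f (Sum.inl e) = Sum.inl e)
    rw [hR, hER] at e1
    have e2 : #{a | ∃ hab : R a b, f (Sum.inl ⟨(a, b), hab⟩) = Sum.inl ⟨(a, b), hab⟩}
        = #{e ∈ edgesR b | f (Sum.inl e) = Sum.inl e} := by
      refine card_bij (fun a ha => ⟨(a, b), (mem_filter.1 ha).2.1⟩) ?_ ?_ ?_
      · intro a ha
        simpa [edgesR] using (mem_filter.1 ha).2.2
      · intro b hb b' hb' hbb
        exact congrArg (fun e : E => e.1.1) hbb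
      · rintro ⟨⟨x, y⟩, hxy⟩ he
        simp only [edgesR, mem_filter, mem_univ, true_and] at he
        obtain ⟨rfl, he⟩ := he
        exact ⟨x, by simpa using ⟨hxy, he⟩, rfl⟩
    have := hdrk b
    have e3 : #{e ∈ edgesR b | f (Sum.inl e) = Sum.inl e} = k := by omega
    convert e2.trans e3

end Matching

/-! ### Pseudorandom bipartite graphs -/

section Pseudorandom

variable {A : Type*} [Fintype A] {R : A → A → Prop} {η q : ℝ}

/-- In a bipartite graph with large degrees on one side and small codegrees on the other, the
degrees on the latter side cannot be much larger than expected. -/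
lemma card_mul_le_of_codegree_le (hη : 0 ≤ η) (hq : 0 < q) (hbig : 1 ≤ η * Fintype.card A * q)
    (hr : ∀ b, (1 - η) * Fintype.card A * q ≤ #{a | R a b})
    (hc : ∀ a a', a ≠ a' → (#{b | R a b ∧ R a' b} : ℝ) ≤ (1 + η) * Fintype.card A * q ^ 2) (a : A) :
    (#{b | R a b} : ℝ) * (1 - 2 * η) ≤ (1 + η) * Fintype.card A * q := by
  set m : ℝ := (Fintype.card A : ℝ) with hm
  set D : ℝ := (#{b | R a b} : ℝ) with hD
  have hm0 : 0 ≤ m := by positivity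
  have hmpos : 0 < m := by
    rcases hm0.lt_or_eq with h | h
    · exact h
    · rw [← h] at hbig; simp at hbig; linarith
  -- Count the paths of length two starting at `a` in two ways: by middle vertex, using the degrees,
  -- and by end vertex, using the codegrees. The end `a' = a` contributes the extra `D`, absorbed
  -- through `1 ≤ η * m * q`.
  have hdc : ∑ a', (#{b | R a b ∧ R a' b} : ℝ) = ∑ b ∈ {b | R a b}, (#{a' | R a' b} : ℝ) := by
    have := sum_card_bipartiteAbove_eq_sum_card_bipartiteBelow (s := (univ : Finset A))
      (t := ({b | R a b} : Finset A)) R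
    simp only [bipartiteAbove, bipartiteBelow, filter_filter] at this
    exact_mod_cast this
  have h1 : D * ((1 - η) * m * q) ≤ ∑ b ∈ {b | R a b}, (#{a' | R a' b} : ℝ) := by
    rw [hD, ← nsmul_eq_mul, ← sum_const]
    exact sum_le_sum fun b _ => hr b
  have h2 : ∑ a', (#{b | R a b ∧ R a' b} : ℝ) ≤ D + m * ((1 + η) * m * q ^ 2) := by
    rw [← add_sum_erase _ _ (mem_univ a)]
    have e1 : (#{b | R a b ∧ R a b} : ℝ) = D := by simp [hD]
    have e2 : ∑ a' ∈ univ.erase a, (#{b | R a b ∧ R a' b} : ℝ)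
        ≤ ∑ a' : A, (1 + η) * m * q ^ 2 := by
      refine (sum_le_sum fun a' ha' => hc a a' (ne_of_mem_erase ha').symm).trans ?_
      exact sum_le_sum_of_subset_of_nonneg (subset_univ _) fun _ _ _ => by positivity
    rw [sum_const, nsmul_eq_mul, card_univ] at e2
    linarith
  have h3 : D * (1 - 2 * η) * (m * q) ≤ (1 + η) * m * q * (m * q) := by
    have : D * 1 ≤ D * (η * m * q) := mul_le_mul_of_nonneg_left hbig (by positivity)
    nlinarith
  exact le_of_mul_le_mul_right h3 (by positivity)

/-- The variance of the number of neighbours in a fixed set. -/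
lemma sum_sq_card_sub_le {D : ℝ} (hη : 0 ≤ η) (hq : 0 ≤ q)
    (hl : ∀ a, (1 - η) * Fintype.card A * q ≤ #{b | R a b}) (hD : ∀ a, (#{b | R a b} : ℝ) ≤ D)
    (hc : ∀ a a', a ≠ a' → (#{b | R a b ∧ R a' b} : ℝ) ≤ (1 + η) * Fintype.card A * q ^ 2)
    (X : Finset A) :
    ∑ b, ((#{a ∈ X | R a b} : ℝ) - #X * q) ^ 2
      ≤ 3 * η * (#X : ℝ) ^ 2 * Fintype.card A * q ^ 2 + #X * D := by
  set m : ℝ := (Fintype.card A : ℝ) with hm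
  have h1 : ∑ b, (#{a ∈ X | R a b} : ℝ) ^ 2 = ∑ a ∈ X, ∑ a' ∈ X, (#{b | R a b ∧ R a' b} : ℝ) := by
    have e1 : ∀ b, (#{a ∈ X | R a b} : ℝ) ^ 2
        = ∑ a ∈ X, ∑ a' ∈ X, if R a b ∧ R a' b then (1 : ℝ) else 0 := by
      intro b
      have : (#{a ∈ X | R a b} : ℝ) = ∑ a ∈ X, if R a b then (1 : ℝ) else 0 := by simp
      rw [this, sq, sum_mul_sum]
      refine sum_congr rfl fun a _ => sum_congr rfl fun a' _ => ?_
      by_cases h : R a b <;> by_cases h' : R a' b <;> simp [h, h']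
    simp_rw [e1]
    rw [sum_comm]
    refine sum_congr rfl fun a _ => ?_
    rw [sum_comm]
    refine sum_congr rfl fun a' _ => ?_
    simp
  have h2 : ∑ a ∈ X, ∑ a' ∈ X, (#{b | R a b ∧ R a' b} : ℝ)
      ≤ #X * (D + #X * ((1 + η) * m * q ^ 2)) := by
    rw [← nsmul_eq_mul, ← sum_const]
    refine sum_le_sum fun a ha => ?_
    rw [← add_sum_erase _ _ ha]
    have e1 : (#{b | R a b ∧ R a b} : ℝ) ≤ D := by simpa using hD a
    have e2 : ∑ a' ∈ X.erase a, (#{b | R a b ∧ R a' b} : ℝ) ≤ ∑ a' ∈ X, (1 + η) * m * q ^ 2 := by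
      refine (sum_le_sum fun a' ha' => hc a a' (ne_of_mem_erase ha').symm).trans ?_
      exact sum_le_sum_of_subset_of_nonneg (erase_subset _ _) fun _ _ _ => by positivity
    rw [sum_const, nsmul_eq_mul] at e2
    linarith
  have h3 : #X * ((1 - η) * m * q) ≤ ∑ b, (#{a ∈ X | R a b} : ℝ) := by
    have := sum_card_bipartiteAbove_eq_sum_card_bipartiteBelow (s := X)
      (t := (univ : Finset A)) R
    simp only [bipartiteAbove, bipartiteBelow] at this
    have h : ∑ b, (#{a ∈ X | R a b} : ℝ) = ∑ a ∈ X, (#{b | R a b} : ℝ) := by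
      exact_mod_cast this.symm
    rw [h, ← nsmul_eq_mul, ← sum_const]
    exact sum_le_sum fun a _ => hl a
  have h4 : ∑ b, ((#{a ∈ X | R a b} : ℝ) - #X * q) ^ 2
      = ∑ b, (#{a ∈ X | R a b} : ℝ) ^ 2 - 2 * (#X * q) * ∑ b, (#{a ∈ X | R a b} : ℝ)
        + m * (#X * q) ^ 2 := by
    have : m * (#X * q) ^ 2 = ∑ _b : A, (#X * q) ^ 2 := by simp [hm]
    rw [this, mul_sum, ← sum_sub_distrib, ← sum_add_distrib]
    exact sum_congr rfl fun b _ => by ring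
  -- The main terms combine to `(1 + η) - 2 * (1 - η) + 1 = 3 * η`; the diagonal pairs give `#X *
  -- D`.
  rw [h4, h1]
  have h5 := mul_le_mul_of_nonneg_left h3 (show 0 ≤ 2 * ((#X : ℝ) * q) by positivity)
  nlinarith

/-- Edge counts between two sets are close to their expected values. -/
lemma sq_edges_sub_le {D : ℝ} (hη : 0 ≤ η) (hq : 0 ≤ q)
    (hl : ∀ a, (1 - η) * Fintype.card A * q ≤ #{b | R a b}) (hD : ∀ a, (#{b | R a b} : ℝ) ≤ D)
    (hc : ∀ a a', a ≠ a' → (#{b | R a b ∧ R a' b} : ℝ) ≤ (1 + η) * Fintype.card A * q ^ 2)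
    (X Z : Finset A) :
    ((∑ a ∈ X, #{b ∈ Z | R a b} : ℕ) - (#X : ℝ) * #Z * q) ^ 2
      ≤ #Z * (3 * η * (#X : ℝ) ^ 2 * Fintype.card A * q ^ 2 + #X * D) := by
  have h1 : ((∑ a ∈ X, #{b ∈ Z | R a b} : ℕ) : ℝ) - (#X : ℝ) * #Z * q
      = ∑ b ∈ Z, ((#{a ∈ X | R a b} : ℝ) - #X * q) := by
    have := sum_card_bipartiteAbove_eq_sum_card_bipartiteBelow (s := X) (t := Z) R
    simp only [bipartiteAbove, bipartiteBelow] at this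
    rw [this, sum_sub_distrib, sum_const, nsmul_eq_mul]
    push_cast; ring
  rw [h1]
  refine sq_sum_le_card_mul_sum_sq.trans (mul_le_mul_of_nonneg_left ?_ (by positivity))
  refine le_trans ?_ (sum_sq_card_sub_le hη hq hl hD hc X)
  exact sum_le_sum_of_subset_of_nonneg (subset_univ _) fun _ _ _ => sq_nonneg _

set_option maxHeartbeats 1000000 in
/-- The inequality behind the factor condition for pseudorandom bipartite graphs. -/
lemma factor_condition_arith {η q δ m x z e e1 e2 : ℝ} (hη : 0 < η) (hq : 0 < q) (hδ0 : 0 ≤ δ)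
    (hδ : δ ≤ 1 / 4) (hηδ : 24 * η ≤ δ ^ 2) (hbig : 3 ≤ η * m * q) (hm0 : 0 ≤ m) (hx0 : 0 ≤ x)
    (hz0 : 0 ≤ z) (hXm : x ≤ m) (hZm : z ≤ m) (hXZ : m < x + z)
    (sumX : x * ((1 - η) * m * q) ≤ e + e2) (sumZ : z * ((1 - η) * m * q) ≤ e + e1)
    (keyXZ : (e - x * z * q) ^ 2
      ≤ z * (3 * η * x ^ 2 * m * q ^ 2 + x * (2 * (m * q))))
    (keyXcZ : (e1 - (m - x) * z * q) ^ 2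
      ≤ z * (3 * η * (m - x) ^ 2 * m * q ^ 2 + (m - x) * (2 * (m * q))))
    (keyXZc : (e2 - x * (m - z) * q) ^ 2
      ≤ (m - z) * (3 * η * x ^ 2 * m * q ^ 2 + x * (2 * (m * q)))) :
    (1 - δ) * m * q * (x + z - m) ≤ e := by
  have hη24 : η ≤ 1 / 384 := by nlinarith
  have hmq : 0 ≤ m * q := by positivity
  have hmqδ : 72 ≤ δ ^ 2 * (m * q) := by
    have := mul_le_mul_of_nonneg_right hηδ hmq
    linarith
  have hmqδ' : 8 ≤ δ * (m * q) := by nlinarith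
  rcases lt_or_ge z (m / 4) with hz | hz
  -- For small `z` the direct estimate of `e` is too weak. Instead `e` is the degree sum of `Z`
  -- minus `e1`, the edges from the complement of `X`, of size `y < z`. These number at most `3 / 4
  -- * y * m * q` plus an error `δ / 2 * m * q * z`; then `3 / 4 ≤ 1 - δ` and `η ≤ δ / 2` suffice.
  · obtain ⟨y, rfl⟩ : ∃ y, x = m - y := ⟨m - x, by ring⟩
    rw [sub_sub_cancel] at keyXcZ
    have hy : 0 ≤ y := by linarith
    have b1 : e1 - y * z * q ≤ y * (m * q) / 2 + δ / 2 * (m * q) * z := by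
      refine (abs_le_of_sq_le_sq' (keyXcZ.trans ?_) (by positivity)).2
      have c1 : z * (3 * η * y ^ 2 * m * q ^ 2) ≤ m / 4 * (3 * η * y ^ 2 * m * q ^ 2) :=
        mul_le_mul_of_nonneg_right hz.le (by positivity)
      have c2 : η * (y * (m * q)) ^ 2 ≤ 1 / 384 * (y * (m * q)) ^ 2 :=
        mul_le_mul_of_nonneg_right hη24 (by positivity)
      have c3 : 8 * (y * z * (m * q)) ≤ δ * (m * q) * (y * z * (m * q)) :=
        mul_le_mul_of_nonneg_right hmqδ' (by positivity)
      have c4 : 0 ≤ (y * (m * q)) ^ 2 := by positivity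
      have c5 : 0 ≤ (δ / 2 * (m * q) * z) ^ 2 := by positivity
      have c6 : 0 ≤ y * z * (m * q) := by positivity
      linarith
    have c1 : y * z * q ≤ y * (m * q) / 4 := by
      have := mul_le_mul_of_nonneg_left hz.le (show 0 ≤ y * q by positivity)
      nlinarith
    have c2 : 0 ≤ z * (m * q) * (δ / 2 - η) := mul_nonneg (by positivity) (by nlinarith)
    have c3 : 0 ≤ y * (m * q) * (1 / 4 - δ) := mul_nonneg (by positivity) (by linarith)
    linarith
  rcases lt_or_ge x (m / 4) with hx | hx
  -- For small `x` the roles are exchanged: `e` is the degree sum of `X` minus the edges into the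
  -- complement of `Z`.
  · obtain ⟨y, rfl⟩ : ∃ y, z = m - y := ⟨m - z, by ring⟩
    rw [sub_sub_cancel] at keyXZc
    have hy : 0 ≤ y := by linarith
    have b1 : e2 - x * y * q ≤ y * (m * q) / 4 + δ / 2 * (m * q) * x := by
      refine (abs_le_of_sq_le_sq' (keyXZc.trans ?_) (by positivity)).2
      have c1 : y * (3 * η * x ^ 2 * m * q ^ 2) ≤ m / 4 * (3 * η * x ^ 2 * m * q ^ 2) :=
        mul_le_mul_of_nonneg_right (by linarith) (by positivity)
      have c2 : 24 * η * (x * (m * q)) ^ 2 ≤ δ ^ 2 * (x * (m * q)) ^ 2 :=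
        mul_le_mul_of_nonneg_right hηδ (by positivity)
      have c3 : 8 * (y * x * (m * q)) ≤ δ * (m * q) * (y * x * (m * q)) :=
        mul_le_mul_of_nonneg_right hmqδ' (by positivity)
      have c4 : 0 ≤ (y * (m * q)) ^ 2 := by positivity
      have c5 : 0 ≤ δ ^ 2 * (x * (m * q)) ^ 2 := by positivity
      linarith
    have c1 : x * y * q ≤ y * (m * q) / 4 := by
      have := mul_le_mul_of_nonneg_left hx.le (show 0 ≤ y * q by positivity)
      nlinarith
    have c2 : 0 ≤ x * (m * q) * (δ / 2 - η) := mul_nonneg (by positivity) (by nlinarith)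
    have c3 : 0 ≤ y * (m * q) * (1 / 4 - δ) := mul_nonneg (by positivity) (by linarith)
    have c4 : 0 ≤ y * (m * q) := by positivity
    linarith
  · have b1 : -(δ * (x * z * q)) ≤ e - x * z * q := by
      refine (abs_le_of_sq_le_sq' (keyXZ.trans ?_) (by positivity)).1
      have c1 : z * (3 * η * x ^ 2 * m * q ^ 2) ≤ z * (3 * η * x ^ 2 * (4 * z) * q ^ 2) := by
        gcongr; linarith
      have c2 : 24 * η * (x * z * q) ^ 2 ≤ δ ^ 2 * (x * z * q) ^ 2 :=
        mul_le_mul_of_nonneg_right hηδ (by positivity)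
      have c3 : m ^ 2 / 16 ≤ x * z := by nlinarith
      have c4 : 72 * m ≤ δ ^ 2 * (m ^ 2 * q) := by
        have := mul_le_mul_of_nonneg_right hmqδ hm0
        linarith
      have c5 : δ ^ 2 * q * (m ^ 2 / 16) ≤ δ ^ 2 * q * (x * z) :=
        mul_le_mul_of_nonneg_left c3 (by positivity)
      have c6 : 4 * m * (x * z * q) ≤ δ ^ 2 * q * (x * z) * (x * z * q) :=
        mul_le_mul_of_nonneg_right (by linarith) (by positivity)
      linarith
    -- When both sets are large, `e ≥ (1 - δ) * x * z * q`, and `(m - x) * (m - z) ≥ 0` means `x * z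
    -- ≥ m * (x + z - m)`.
    have c1 : 0 ≤ (m - x) * (m - z) * ((1 - δ) * q) :=
      mul_nonneg (mul_nonneg (by linarith) (by linarith)) (mul_nonneg (by linarith) hq.le)
    linarith

/-- A pseudorandom bipartite graph satisfies the condition of the factor theorem. -/
lemma factor_condition {δ : ℝ} (hη : 0 < η) (hq : 0 < q) (hδ0 : 0 ≤ δ) (hδ : δ ≤ 1 / 4)
    (hηδ : 24 * η ≤ δ ^ 2) (hbig : 3 ≤ η * Fintype.card A * q)
    (hl : ∀ a, (1 - η) * Fintype.card A * q ≤ #{b | R a b})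
    (hr : ∀ b, (1 - η) * Fintype.card A * q ≤ #{a | R a b})
    (hc : ∀ a a', a ≠ a' → (#{b | R a b ∧ R a' b} : ℝ) ≤ (1 + η) * Fintype.card A * q ^ 2)
    {k : ℕ} (hk : (k : ℝ) ≤ (1 - δ) * Fintype.card A * q) (X Z : Finset A) :
    k * (#X + #Z) ≤ k * Fintype.card A + ∑ a ∈ X, #{b ∈ Z | R a b} := by
  rcases le_or_gt (#X + #Z) (Fintype.card A) with hXZ | hXZ
  · exact (Nat.mul_le_mul_left k hXZ).trans (Nat.le_add_right _ _)
  have hη24 : η ≤ 1 / 384 := by nlinarith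
  have hD : ∀ a, (#{b | R a b} : ℝ) ≤ 2 * (Fintype.card A * q) := fun a => by
    have h := card_mul_le_of_codegree_le hη.le hq (by linarith) hr hc a
    have h0 : (0 : ℝ) ≤ #{b | R a b} := by positivity
    have h1 : 0 ≤ (Fintype.card A : ℝ) * q := by positivity
    nlinarith
  have key := sq_edges_sub_le hη.le hq.le hl hD hc
  have hXc : (#Xᶜ : ℝ) = Fintype.card A - #X := by
    rw [card_compl, Nat.cast_sub (card_le_univ X)]
  have hZc : (#Zᶜ : ℝ) = Fintype.card A - #Z := by
    rw [card_compl, Nat.cast_sub (card_le_univ Z)]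
  have hXm : (#X : ℝ) ≤ Fintype.card A := by exact_mod_cast card_le_univ X
  have hZm : (#Z : ℝ) ≤ Fintype.card A := by exact_mod_cast card_le_univ Z
  have hXZ' : (Fintype.card A : ℝ) < #X + #Z := by exact_mod_cast hXZ
  suffices hs : (1 - δ) * Fintype.card A * q * ((#X : ℝ) + #Z - Fintype.card A)
      ≤ ((∑ a ∈ X, #{b ∈ Z | R a b} : ℕ) : ℝ) by
    have h1 := mul_le_mul_of_nonneg_right hk
      (show 0 ≤ (#X : ℝ) + #Z - Fintype.card A by linarith)
    have h2 : (k : ℝ) * (#X + #Z)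
        ≤ k * Fintype.card A + ((∑ a ∈ X, #{b ∈ Z | R a b} : ℕ) : ℝ) := by linarith
    exact_mod_cast h2
  have hm0 : (0 : ℝ) ≤ Fintype.card A := by positivity
  have hx0 : (0 : ℝ) ≤ #X := by positivity
  have hz0 : (0 : ℝ) ≤ #Z := by positivity
  have keyXZ := key X Z
  have keyXcZ := key Xᶜ Z
  have keyXZc := key X Zᶜ
  rw [hXc] at keyXcZ
  rw [hZc] at keyXZc
  have sumZ : #Z * ((1 - η) * Fintype.card A * q) ≤ ((∑ a ∈ X, #{b ∈ Z | R a b} : ℕ) : ℝ)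
      + ((∑ a ∈ Xᶜ, #{b ∈ Z | R a b} : ℕ) : ℝ) := by
    have h1 := sum_card_bipartiteAbove_eq_sum_card_bipartiteBelow (s := (univ : Finset A))
      (t := Z) R
    simp only [bipartiteAbove, bipartiteBelow] at h1
    rw [← Nat.cast_add, sum_add_sum_compl, h1, Nat.cast_sum, ← nsmul_eq_mul, ← sum_const]
    exact sum_le_sum fun b _ => hr b
  have sumX : #X * ((1 - η) * Fintype.card A * q) ≤ ((∑ a ∈ X, #{b ∈ Z | R a b} : ℕ) : ℝ)
      + ((∑ a ∈ X, #{b ∈ Zᶜ | R a b} : ℕ) : ℝ) := by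
    rw [← Nat.cast_add, ← sum_add_distrib, Nat.cast_sum, ← nsmul_eq_mul, ← sum_const]
    refine sum_le_sum fun a _ => (hl a).trans ?_
    rw [← card_union_of_disjoint (disjoint_filter_filter disjoint_compl_right), ← filter_union,
      union_compl]
  generalize ((∑ a ∈ X, #{b ∈ Z | R a b} : ℕ) : ℝ) = e at *
  generalize ((∑ a ∈ Xᶜ, #{b ∈ Z | R a b} : ℕ) : ℝ) = e1 at *
  generalize ((∑ a ∈ X, #{b ∈ Zᶜ | R a b} : ℕ) : ℝ) = e2 at *
  generalize (#X : ℝ) = x at *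
  generalize (#Z : ℝ) = z at *
  generalize (Fintype.card A : ℝ) = m at *
  exact factor_condition_arith hη hq hδ0 hδ hηδ hbig hm0 hx0 hz0 hXm hZm hXZ' sumX sumZ keyXZ
    keyXcZ keyXZc

/-- A pseudorandom bipartite graph contains many disjoint perfect matchings. -/
theorem exists_disjoint_perms {δ : ℝ} (hη : 0 < η) (hq : 0 < q) (hδ0 : 0 ≤ δ) (hδ : δ ≤ 1 / 4)
    (hηδ : 24 * η ≤ δ ^ 2) (hbig : 3 ≤ η * Fintype.card A * q)
    (hl : ∀ a, (1 - η) * Fintype.card A * q ≤ #{b | R a b})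
    (hr : ∀ b, (1 - η) * Fintype.card A * q ≤ #{a | R a b})
    (hc : ∀ a a', a ≠ a' → (#{b | R a b ∧ R a' b} : ℝ) ≤ (1 + η) * Fintype.card A * q ^ 2)
    {k : ℕ} (hk : (k : ℝ) ≤ (1 - δ) * Fintype.card A * q) :
    ∃ σ : Fin k → Equiv.Perm A, (∀ i a, R a (σ i a)) ∧ ∀ i j a, i ≠ j → σ i a ≠ σ j a := by
  obtain ⟨K, hKR, hK1, hK2⟩ := exists_regular_subrelation R k
    (factor_condition hη hq hδ0 hδ hηδ hbig hl hr hc hk)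
  obtain ⟨σ, hσ, hd⟩ := exists_perms_of_regular k K hK1 hK2
  exact ⟨σ, fun i a => hKR _ _ (hσ i a), hd⟩

end Pseudorandom

/-! ### From matchings to tree factors -/

section Factor

/-- Group-valued labels on the edges of a tree come from a potential on the vertices. -/
lemma exists_potential {V Γ : Type*} [Group Γ] {T : SimpleGraph V} (hT : T.IsTree)
    (σ : V → V → Γ) (hσ : ∀ u v, T.Adj u v → σ v u = (σ u v)⁻¹) :
    ∃ g : V → Γ, ∀ u v, T.Adj u v → g v = σ u v * g u := by
  obtain ⟨r⟩ := hT.connected.nonempty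
  choose P hP hPu using fun v => hT.existsUnique_path r v
  let lab : ∀ {u v : V}, T.Walk u v → Γ := fun {u v} w =>
    (w.darts.map fun d => σ d.fst d.snd).reverse.prod
  have hcon : ∀ {u v : V} (w : T.Walk r u) (h : T.Adj u v), lab (w.concat h) = σ u v * lab w := by
    intro u v w h
    simp [lab, SimpleGraph.Walk.darts_concat]
  refine ⟨fun v => lab (P v), fun u v huv => ?_⟩
  -- The potential is the ordered product of labels along the path from the root. Of two adjacent
  -- vertices, one is the predecessor of the other on its path from the root.
  by_cases hv : v ∈ (P u).support
  · have h2 := hT.isAcyclic.path_concat (hP v) (hP u) huv.symm hv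
    show lab (P v) = σ u v * lab (P u)
    rw [h2, hcon, hσ u v huv, mul_inv_cancel_left]
  · have h1 := hT.isAcyclic.mem_support_of_ne_mem_support_of_adj_of_isPath (hP v) (hP u) huv.symm hv
    have h2 := hT.isAcyclic.path_concat (hP u) (hP v) huv h1
    show lab (P v) = σ u v * lab (P u)
    rw [h2, hcon]

variable {t m : ℕ} {V : Type*}

/-- Matchings along the edges of a tree between the classes of an equipartition form a factor. -/
lemma exists_factor {T : SimpleGraph (Fin t)} (hT : T.IsTree) (G : SimpleGraph V)
    (v : Fin t × Fin m ≃ V) (σ : Fin t → Fin t → Equiv.Perm (Fin m))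
    (hσ : ∀ i j, T.Adj i j → σ j i = (σ i j)⁻¹)
    (hG : ∀ i j a, T.Adj i j → G.Adj (v (i, a)) (v (j, σ i j a))) :
    ∃ F : Set G.Subgraph, IsFactor T G F ∧
      factorEdges F = {e | ∃ i j a, T.Adj i j ∧ e = s(v (i, a), v (j, σ i j a))} := by
  obtain ⟨g, hg⟩ := exists_potential hT σ hσ
  -- The copy with index `x` uses, in class `i`, the vertex at position `g i x`. As each `g i` is a
  -- permutation, the copies partition the vertices.
  let φ : Fin m → T →g G := fun x => ⟨fun i => v (i, g i x), fun {i j} hij => by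
    rw [hg i j hij]; exact hG i j _ hij⟩
  have hφ : ∀ x, Function.Injective (φ x) := fun x i j hij =>
    congrArg Prod.fst (v.injective hij)
  let c : Fin m → SimpleGraph.Copy T G := fun x => ⟨φ x, hφ x⟩
  have hv : ∀ x w, w ∈ (c x).toSubgraph.verts ↔ ∃ i, v (i, g i x) = w := by
    intro x w
    simp [SimpleGraph.Copy.toSubgraph, c, φ]
  refine ⟨Set.range fun x => (c x).toSubgraph, ⟨?_, ?_, ?_⟩, ?_⟩
  · rintro _ ⟨x, rfl⟩
    exact ⟨(c x).isoToSubgraph.symm⟩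
  · rintro _ ⟨x, rfl⟩ _ ⟨y, rfl⟩ hxy
    rw [Set.disjoint_left]
    intro w hw hw'
    rw [hv] at hw hw'
    obtain ⟨i, rfl⟩ := hw
    obtain ⟨j, hj⟩ := hw'
    have h := v.injective hj
    simp only [Prod.mk.injEq] at h
    obtain ⟨rfl, h⟩ := h
    exact hxy (by rw [(g j).injective h])
  · intro w
    obtain ⟨⟨i, a⟩, rfl⟩ := v.surjective w
    refine ⟨_, ⟨(g i).symm a, rfl⟩, (hv _ _).2 ⟨i, by simp⟩⟩
  · ext e
    simp only [factorEdges, Set.mem_range, Set.iUnion_exists, Set.iUnion_iUnion_eq', Set.mem_iUnion]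
    constructor
    · rintro ⟨x, hx⟩
      induction e with | _ p q
      rw [SimpleGraph.Subgraph.mem_edgeSet] at hx
      obtain ⟨i, j, hij, rfl, rfl⟩ := hx
      refine ⟨i, j, g i x, hij, ?_⟩
      rw [← Equiv.Perm.mul_apply, ← hg i j hij]
      rfl
    · rintro ⟨i, j, a, hij, rfl⟩
      refine ⟨(g i).symm a, ?_⟩
      rw [SimpleGraph.Subgraph.mem_edgeSet]
      refine ⟨i, j, hij, ?_, ?_⟩
      · simp [c, φ]
      · simp [c, φ, hg i j hij]

/-- A tree on `Fin t` has `t - 1` edges `(i, j)` with `i < j`. -/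
lemma card_ordered_edges {T : SimpleGraph (Fin t)} (hT : T.IsTree) :
    #{p : Fin t × Fin t | T.Adj p.1 p.2 ∧ p.1 < p.2} + 1 = t := by
  have h := hT.card_edgeFinset
  rw [Fintype.card_fin] at h
  refine Eq.trans (congrArg (· + 1) ?_) h
  refine card_bij (fun p _ => s(p.1, p.2)) ?_ ?_ ?_
  · intro p hp
    simpa using (mem_filter.1 hp).2.1
  · rintro ⟨i, j⟩ hp ⟨i', j'⟩ hp' h
    simp only [mem_filter, mem_univ, true_and, Sym2.eq_iff, Prod.mk.injEq] at *
    rcases h with h | ⟨rfl, rfl⟩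
    · exact h
    · exact absurd hp.2 hp'.2.asymm
  · intro e
    induction e with | _ i j
    intro he
    rw [SimpleGraph.mem_edgeFinset, SimpleGraph.mem_edgeSet] at he
    rcases lt_or_gt_of_ne he.ne with h | h
    · exact ⟨(i, j), by simp [he, h], rfl⟩
    · exact ⟨(j, i), by simp [he.symm, h], Sym2.eq_swap⟩

variable [Fintype V]

/-- Disjoint matchings between the classes of several equipartitions, which use disjoint sets of
edges for distinct partitions, assemble to a packing of tree factors. -/
theorem hasFactorPacking_of_matchings {T : SimpleGraph (Fin t)} (hT : T.IsTree)
    (G : SimpleGraph V) {r k : ℕ} (v : Fin r → Fin t × Fin m ≃ V) (c : Sym2 V → Fin r)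
    (hM : ∀ l i j, T.Adj i j → i < j → ∃ σ : Fin k → Equiv.Perm (Fin m),
      (∀ x a, G.Adj (v l (i, a)) (v l (j, σ x a)) ∧ c s(v l (i, a), v l (j, σ x a)) = l) ∧
      ∀ x y a, x ≠ y → σ x a ≠ σ y a) {δ : ℝ}
    (hδ : (1 - δ) * G.edgeSet.ncard ≤ r * k * ((t : ℝ) - 1) * m) :
    HasFactorPacking T G δ := by
  have hinv : ∀ (π : Equiv.Perm (Fin m)) a, π (π⁻¹ a) = a := fun π a => π.apply_symm_apply a
  choose! σ hσ hd using hM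
  -- Matchings are given for `i < j` only; the reverse orientation uses the inverse permutation.
  let τ : Fin r → Fin k → Fin t → Fin t → Equiv.Perm (Fin m) := fun l x i j =>
    if i < j then σ l i j x else (σ l j i x)⁻¹
  have hτ : ∀ l x i j, T.Adj i j → τ l x j i = (τ l x i j)⁻¹ := by
    intro l x i j hij
    rcases lt_or_gt_of_ne hij.ne with h | h
    · simp [τ, h, h.not_gt]
    · simp [τ, h, h.not_gt]
  have hτG : ∀ l x i j a, T.Adj i j → G.Adj (v l (i, a)) (v l (j, τ l x i j a)) ∧
      c s(v l (i, a), v l (j, τ l x i j a)) = l := by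
    intro l x i j a hij
    rcases lt_or_gt_of_ne hij.ne with h | h
    · simpa [τ, h] using hσ l i j hij h x a
    · have := hσ l j i hij.symm h x ((σ l j i x)⁻¹ a)
      rw [hinv, Sym2.eq_swap] at this
      simpa [τ, h.not_gt] using ⟨this.1.symm, this.2⟩
  have hτd : ∀ l x y i j a, T.Adj i j → x ≠ y → τ l x i j a ≠ τ l y i j a := by
    intro l x y i j a hij hxy h'
    rcases lt_or_gt_of_ne hij.ne with h | h
    · simp only [τ, h, if_true] at h'
      exact hd l i j hij h x y a hxy h'
    · simp only [τ, h.not_gt, if_false] at h'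
      refine hd l j i hij.symm h x y ((σ l j i x)⁻¹ a) hxy ?_
      rw [hinv, h', hinv]
  choose F hF hFE using fun p : Fin r × Fin k => exists_factor hT G (v p.1) (τ p.1 p.2)
    (hτ p.1 p.2) (fun i j a hij => (hτG p.1 p.2 i j a hij).1)
  -- Within one partition an edge determines its classes and positions up to orientation, so
  -- disjoint matchings give edge-disjoint factors. Across partitions the colour `c` separates the
  -- edges.
  have hsame : ∀ l x y e, e ∈ factorEdges (F (l, x)) → e ∈ factorEdges (F (l, y)) → x = y := by
    intro l x y e h1 h2
    rw [hFE] at h1 h2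
    obtain ⟨i, j, a, hij, rfl⟩ := h1
    obtain ⟨i', j', a', hij', he⟩ := h2
    by_contra hxy
    simp only [Sym2.eq_iff, EmbeddingLike.apply_eq_iff_eq, Prod.mk.injEq] at he
    rcases he with ⟨⟨h1, h2⟩, h3, h4⟩ | ⟨⟨h1, h2⟩, h3, h4⟩
    · subst h1 h2 h3
      exact hτd l x y _ _ _ hij hxy h4
    · subst h1 h3
      rw [hτ l y _ _ hij] at h2
      refine hτd l x y _ _ a hij hxy ?_
      rw [h4, h2, hinv]
  have hcl : ∀ p e, e ∈ factorEdges (F p) → e ∈ G.edgeSet ∧ c e = p.1 := by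
    intro p e he
    rw [hFE] at he
    obtain ⟨i, j, a, hij, rfl⟩ := he
    exact hτG p.1 p.2 i j a hij
  refine ⟨r * k, fun x => F (finProdFinEquiv.symm x), fun x => hF _, ?_, ?_⟩
  · intro x y hxy
    rw [Set.disjoint_left]
    intro e h1 h2
    apply hxy
    apply finProdFinEquiv.symm.injective
    have h3 := (hcl _ e h1).2.symm.trans (hcl _ e h2).2
    refine Prod.ext h3 (hsame (finProdFinEquiv.symm y).1 _ _ e ?_ h2)
    rw [← h3]
    exact h1
  · set U : Set (Sym2 V) := ⋃ x, factorEdges (F (finProdFinEquiv.symm x)) with hU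
    have hUG : U ⊆ G.edgeSet := Set.iUnion_subset fun x e he => (hcl _ e he).1
    have hmem : ∀ l x i j a, T.Adj i j → s(v l (i, a), v l (j, τ l x i j a)) ∈
        factorEdges (F (l, x)) := by
      intro l x i j a hij
      rw [hFE]
      exact ⟨i, j, a, hij, rfl⟩
    have hcard : r * (k * (#{p : Fin t × Fin t | T.Adj p.1 p.2 ∧ p.1 < p.2} * m)) ≤ U.ncard := by
      rw [Set.ncard_eq_toFinset_card']
      calc _ = #((univ : Finset (Fin r)) ×ˢ (univ : Finset (Fin k)) ×ˢ
            ({p : Fin t × Fin t | T.Adj p.1 p.2 ∧ p.1 < p.2} : Finset _) ×ˢ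
            (univ : Finset (Fin m))) := by simp [card_product]
        _ ≤ _ := by
          refine card_le_card_of_injOn (fun z => s(v z.1 (z.2.2.1.1, z.2.2.2),
            v z.1 (z.2.2.1.2, τ z.1 z.2.1 z.2.2.1.1 z.2.2.1.2 z.2.2.2))) ?_ ?_
          · rintro ⟨l, x, ⟨i, j⟩, a⟩ hz
            simp only [coe_product, coe_univ, Set.mem_prod, Set.mem_univ, true_and, and_true,
              coe_filter, mem_univ, Set.mem_ofPred_eq] at hz
            rw [mem_coe, Set.mem_toFinset, hU, Set.mem_iUnion]
            exact ⟨finProdFinEquiv (l, x), by simpa using hmem l x i j a hz.1⟩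
          · rintro ⟨l, x, ⟨i, j⟩, a⟩ hz ⟨l', x', ⟨i', j'⟩, a'⟩ hz' he
            simp only [coe_product, coe_univ, Set.mem_prod, Set.mem_univ, true_and, and_true,
              coe_filter, mem_univ, Set.mem_ofPred_eq] at hz hz' he
            have e1 := hmem l x i j a hz.1
            have e2 := hmem l' x' i' j' a' hz'.1
            rw [← he] at e2
            have e3 : l = l' := (hcl _ _ e1).2.symm.trans (hcl _ _ e2).2
            subst e3
            have e4 : x = x' := hsame l _ _ _ e1 e2
            subst e4
            simp only [Sym2.eq_iff, EmbeddingLike.apply_eq_iff_eq, Prod.mk.injEq] at he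
            rcases he with ⟨⟨h1, h2⟩, h3, h4⟩ | ⟨⟨h1, h2⟩, h3, h4⟩
            · subst h1 h2 h3; rfl
            · subst h1 h3; exact absurd hz.2 hz'.2.asymm
    have hE : ((#{p : Fin t × Fin t | T.Adj p.1 p.2 ∧ p.1 < p.2} : ℕ) : ℝ) = (t : ℝ) - 1 := by
      rw [eq_sub_iff_add_eq]; exact_mod_cast card_ordered_edges hT
    have hcard' : (r : ℝ) * k * ((t : ℝ) - 1) * m ≤ U.ncard := by
      rw [← hE]; rw [← mul_assoc, ← mul_assoc] at hcard; exact_mod_cast hcard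
    have hdiff := Set.ncard_sdiff_add_ncard_of_subset hUG
    have hdiff' : ((G.edgeSet \ U).ncard : ℝ) + U.ncard = G.edgeSet.ncard := by exact_mod_cast hdiff
    linarith

end Factor

/-! ### Random equipartitions and random assignment of edges -/

section RandomPartition

lemma prob_mem_eq_sum {Ω β : Type*} (S : Finset Ω) (f : Ω → β) (P : Finset β) :
    prob S (fun ω => f ω ∈ P) = ∑ y ∈ P, prob S (fun ω => f ω = y) := by
  have h : #{ω ∈ S | f ω ∈ P} = ∑ y ∈ P, #{ω ∈ S | f ω = y} := by
    rw [card_eq_sum_card_fiberwise (f := f) (t := P) (by intro ω; simp)]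
    refine sum_congr rfl fun y hy => ?_
    congr 1
    ext ω
    simp only [mem_filter]
    constructor
    · rintro ⟨⟨h1, -⟩, h2⟩; exact ⟨h1, h2⟩
    · rintro ⟨h1, rfl⟩; exact ⟨⟨h1, hy⟩, rfl⟩
  simp only [prob, h, Nat.cast_sum, sum_div]

lemma dependsOn_coord {ι α : Type*} (i : ι) (Q : α → Prop) :
    DependsOn (fun ω : ι → α => Q (ω i)) {i} :=
  fun x y h => by simp only [h i rfl]

lemma dependsOn_and {ι α : Type*} {P Q : (ι → α) → Prop} {B C : Set ι} (hP : DependsOn P B)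
    (hQ : DependsOn Q C) : DependsOn (fun ω => P ω ∧ Q ω) (B ∪ C) := fun x y h => by
  simp only [hP fun i hi => h i (Or.inl hi), hQ fun i hi => h i (Or.inr hi)]

variable {t m r : ℕ} {V : Type*}

section Shift

variable [NeZero t] (e : V ≃ Fin m × Fin t)

/-- The equipartition obtained by shifting each group of `t` vertices cyclically. -/
def shiftEquiv (s : Fin m → Fin t) : Fin t × Fin m ≃ V where
  -- The position of a vertex inside its class is the number of its group. Hence the vertex at
  -- position `a` depends on the single shift `s a`, which makes the positions of a class
  -- independent.
  toFun p := e.symm (p.2, p.1 - s p.2)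
  invFun u := ((e u).2 + s (e u).1, (e u).1)
  left_inv p := by simp
  right_inv u := by simp

lemma prob_coord_add {ι : Type*} [Fintype ι] (x : ι) (c i : Fin t) :
    prob (choices fun _ : ι => (univ : Finset (Fin t))) (fun ω => c + ω x = i)
      = (t : ℝ)⁻¹ := by
  have h := prob_eq_inv (fun _ : ι => (univ : Finset (Fin t))) (fun _ => univ_nonempty) x
    (mem_univ (i - c))
  rw [card_univ, Fintype.card_fin] at h
  rw [← h]
  congr 1
  ext ω
  rw [eq_sub_iff_add_eq, add_comm]

/-- The expected size of the intersection of a set with a class. -/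
lemma sum_prob_shift (S : Finset V) (l : Fin r) (i : Fin t) :
    ∑ a : Fin m, prob (choices fun _ : Fin r × Fin m => (univ : Finset (Fin t)))
      (fun ω => shiftEquiv e (fun a => ω (l, a)) (i, a) ∈ S) = #S / t := by
  have h1 : ∀ a : Fin m, prob (choices fun _ : Fin r × Fin m => (univ : Finset (Fin t)))
      (fun ω => shiftEquiv e (fun a => ω (l, a)) (i, a) ∈ S)
      = #{u ∈ S | (e u).1 = a} * (t : ℝ)⁻¹ := by
    intro a
    rw [← nsmul_eq_mul, ← sum_const]
    have h2 : ∀ u ∈ ({u ∈ S | (e u).1 = a} : Finset V), (t : ℝ)⁻¹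
        = prob (choices fun _ : Fin r × Fin m => (univ : Finset (Fin t)))
          (fun ω => shiftEquiv e (fun a => ω (l, a)) (i, a) = u) := by
      intro u hu
      rw [← prob_coord_add (l, a) (e u).2 i]
      congr 1
      ext ω
      have hu2 := (mem_filter.1 hu).2
      rw [← Equiv.eq_symm_apply]
      simp [shiftEquiv, hu2, eq_comm]
    rw [sum_congr rfl h2, ← prob_mem_eq_sum]
    congr 1
    ext ω
    simp [shiftEquiv]
  simp_rw [h1]
  rw [← sum_mul, div_eq_mul_inv]
  congr 1
  rw [← Nat.cast_sum, ← card_eq_sum_card_fiberwise (f := fun u => (e u).1) (t := univ)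
    (by intro u; simp)]

/-- The probability that a pair of vertices of distinct groups lies between adjacent classes. -/
lemma prob_adj_shift (T : SimpleGraph (Fin t)) {u w : V} (huw : (e u).1 ≠ (e w).1) (l : Fin r) :
    prob (choices fun _ : Fin r × Fin m => (univ : Finset (Fin t)))
      (fun ω => T.Adj ((shiftEquiv e fun a => ω (l, a)).symm u).1
        ((shiftEquiv e fun a => ω (l, a)).symm w).1)
      = #{p : Fin t × Fin t | T.Adj p.1 p.2} / (t : ℝ) ^ 2 := by
  have h1 := prob_mem_eq_sum
    (choices fun _ : Fin r × Fin m => (univ : Finset (Fin t)))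
    (fun ω => ((e u).2 + ω (l, (e u).1), (e w).2 + ω (l, (e w).1)))
    {p : Fin t × Fin t | T.Adj p.1 p.2}
  simp only [mem_filter, mem_univ, true_and] at h1
  refine (Eq.trans ?_ h1).trans ?_
  · rfl
  · rw [div_eq_mul_inv, ← nsmul_eq_mul, ← sum_const]
    refine sum_congr rfl fun p _ => ?_
    -- The two shifts are distinct coordinates because the groups differ; this is why edges inside
    -- groups are excluded.
    have h2 := prob_and (fun _ : Fin r × Fin m => (univ : Finset (Fin t)))
      (dependsOn_coord (l, (e u).1) fun y => (e u).2 + y = p.1)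
      (dependsOn_coord (l, (e w).1) fun y => (e w).2 + y = p.2) (by simp [huw])
    simp only [prob_coord_add] at h2
    rw [sq, mul_inv, ← h2]
    congr 1
    ext ω
    rw [Prod.ext_iff]

/-- Random shifts yield equipartitions which split all neighbourhoods and common neighbourhoods
evenly, and in which every pair of vertices of distinct groups lies equally often between
adjacent classes. -/
lemma exists_shifts [Fintype V] (T : SimpleGraph (Fin t)) (N : V → Finset V) {ε Md Mc K β : ℝ}
    (hε0 : 0 ≤ ε) (hε1 : ε ≤ 1) (hK : K = r * (#{p : Fin t × Fin t | T.Adj p.1 p.2} / (t : ℝ) ^ 2))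
    (hd : ∀ u, Md ≤ #(N u) / t) (hc : ∀ u w, u ≠ w → (#(N u ∩ N w) : ℝ) / t ≤ Mc)
    (hβd : Real.exp (-(ε ^ 2 * Md / 4)) ≤ β) (hβc : Real.exp (-(ε ^ 2 * Mc / 4)) ≤ β)
    (hβK : Real.exp (-(ε ^ 2 * K / 4)) ≤ β)
    (hβ : ((Fintype.card V * (r * t) + Fintype.card V * (Fintype.card V * (r * t))
      + Fintype.card V * Fintype.card V + Fintype.card V * Fintype.card V : ℕ) : ℝ) * β < 1) :
    ∃ s : Fin r → Fin m → Fin t,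
      (∀ u l i, (1 - ε) * Md ≤ #{a | shiftEquiv e (s l) (i, a) ∈ N u}) ∧
      (∀ u w l i, u ≠ w → (#{a | shiftEquiv e (s l) (i, a) ∈ N u ∩ N w} : ℝ) ≤ (1 + ε) * Mc) ∧
      ∀ u w, (e u).1 ≠ (e w).1 →
        (1 - ε) * K ≤ #{l | T.Adj ((shiftEquiv e (s l)).symm u).1 ((shiftEquiv e (s l)).symm w).1} ∧
        (#{l | T.Adj ((shiftEquiv e (s l)).symm u).1 ((shiftEquiv e (s l)).symm w).1} : ℝ)
          ≤ (1 + ε) * K := by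
  set L : Fin r × Fin m → Finset (Fin t) := fun _ => univ
  have hL : ∀ x, (L x).Nonempty := fun _ => univ_nonempty
  have hΩ : (choices L).Nonempty := choices_nonempty hL
  have hβ0 : 0 ≤ β := (Real.exp_nonneg _).trans hβd
  have hdep : ∀ (S : Finset V) l i (a : Fin m), DependsOn
      (fun ω : Fin r × Fin m → Fin t => shiftEquiv e (fun a => ω (l, a)) (i, a) ∈ S) {(l, a)} := by
    intro S l i a x y h
    simp only [shiftEquiv, Equiv.coe_fn_mk, h (l, a) rfl]
  have hdisj : ∀ (l : Fin r), ∀ a ∈ (univ : Finset (Fin m)), ∀ a' ∈ (univ : Finset (Fin m)), a ≠ a' →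
      Disjoint ({(l, a)} : Set (Fin r × Fin m)) {(l, a')} := by
    intro l a _ a' _ h
    simp [h]
  have hdep' : ∀ (u w : V), ∀ l ∈ (univ : Finset (Fin r)), DependsOn
      (fun ω : Fin r × Fin m → Fin t => T.Adj ((shiftEquiv e fun a => ω (l, a)).symm u).1
        ((shiftEquiv e fun a => ω (l, a)).symm w).1) {x | x.1 = l} := by
    intro u w l _ x y h
    simp only [shiftEquiv, Equiv.coe_fn_symm_mk, h (l, _) rfl]
  have hdisj' : ∀ l ∈ (univ : Finset (Fin r)), ∀ l' ∈ (univ : Finset (Fin r)), l ≠ l' →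
      Disjoint {x : Fin r × Fin m | x.1 = l} {x | x.1 = l'} := by
    intro l _ l' _ h
    rw [Set.disjoint_left]
    rintro x rfl h2
    exact h h2
  have hmeanK : ∀ u w, (e u).1 ≠ (e w).1 → ∑ l : Fin r, prob (choices L)
      (fun ω => T.Adj ((shiftEquiv e fun a => ω (l, a)).symm u).1
        ((shiftEquiv e fun a => ω (l, a)).symm w).1) = K := by
    intro u w huw
    rw [sum_congr rfl fun l _ => prob_adj_shift e T huw l, sum_const, nsmul_eq_mul, card_univ,
      Fintype.card_fin, hK]
  let bad : (V × Fin r × Fin t) ⊕ (V × V × Fin r × Fin t) ⊕ (V × V) ⊕ (V × V) →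
      (Fin r × Fin m → Fin t) → Prop := Sum.elim
    (fun k ω => (#{a | shiftEquiv e (fun a => ω (k.2.1, a)) (k.2.2, a) ∈ N k.1} : ℝ) < (1 - ε) * Md)
    (Sum.elim
      (fun k ω => k.1 ≠ k.2.1 ∧ (1 + ε) * Mc <
        #{a | shiftEquiv e (fun a => ω (k.2.2.1, a)) (k.2.2.2, a) ∈ N k.1 ∩ N k.2.1})
      (Sum.elim
        (fun k ω => (e k.1).1 ≠ (e k.2).1 ∧
          (#{l | T.Adj ((shiftEquiv e fun a => ω (l, a)).symm k.1).1
            ((shiftEquiv e fun a => ω (l, a)).symm k.2).1} : ℝ) < (1 - ε) * K)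
        (fun k ω => (e k.1).1 ≠ (e k.2).1 ∧ (1 + ε) * K <
          #{l | T.Adj ((shiftEquiv e fun a => ω (l, a)).symm k.1).1
            ((shiftEquiv e fun a => ω (l, a)).symm k.2).1})))
  have hside : ∀ (Q : Prop) (P : (Fin r × Fin m → Fin t) → Prop),
      (Q → prob (choices L) P ≤ β) →
      prob (choices L) (fun ω => Q ∧ P ω) ≤ β := by
    intro Q P h
    by_cases hQ : Q
    · simpa [hQ] using h hQ
    · simpa [hQ, prob] using hβ0
  obtain ⟨ω, -, hω⟩ := exists_forall_not_of_sum_prob_lt (choices L) hΩ univ bad (b := β)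
    (by
      rintro (⟨u, l, i⟩ | ⟨u, w, l, i⟩ | ⟨u, w⟩ | ⟨u, w⟩) -
      · refine le_trans ?_ hβd
        exact prob_lower_tail L hL univ _ _ (fun a _ => hdep (N u) l i a) (hdisj l) hε0 hε1
          ((hd u).trans_eq (sum_prob_shift e (N u) l i).symm)
      · refine hside _ _ fun huw => le_trans ?_ hβc
        exact prob_upper_tail L hL univ _ _ (fun a _ => hdep (N u ∩ N w) l i a) (hdisj l) hε0 hε1
          ((sum_prob_shift e (N u ∩ N w) l i).trans_le (hc u w huw))
      · refine hside _ _ fun huw => le_trans ?_ hβK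
        exact prob_lower_tail L hL univ _ _ (hdep' u w) hdisj' hε0 hε1 (hmeanK u w huw).ge
      · refine hside _ _ fun huw => le_trans ?_ hβK
        exact prob_upper_tail L hL univ _ _ (hdep' u w) hdisj' hε0 hε1 (hmeanK u w huw).le) (by
      rw [card_univ]
      simp only [Fintype.card_sum, Fintype.card_prod, Fintype.card_fin]
      convert hβ using 3
      ring)
  refine ⟨fun l a => ω (l, a), fun u l i => ?_, fun u w l i huw => ?_, fun u w huw => ⟨?_, ?_⟩⟩
  · exact not_lt.1 (hω (Sum.inl (u, l, i)) (mem_univ _))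
  · exact not_lt.1 fun h => hω (Sum.inr (Sum.inl (u, w, l, i))) (mem_univ _) ⟨huw, h⟩
  · exact not_lt.1 fun h => hω (Sum.inr (Sum.inr (Sum.inl (u, w)))) (mem_univ _) ⟨huw, h⟩
  · exact not_lt.1 fun h => hω (Sum.inr (Sum.inr (Sum.inr (u, w)))) (mem_univ _) ⟨huw, h⟩

end Shift

/-- Assigning every edge at random to one of the partitions in which it lies between adjacent
classes thins all degrees and codegrees evenly. -/
lemma exists_edge_assignment [Fintype V] (T : SimpleGraph (Fin t)) (v : Fin r → Fin t × Fin m ≃ V)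
    (N : V → Finset V) {ε Md Mc K₁ K₂ β : ℝ} (hr : 0 < r)
    (hε0 : 0 ≤ ε) (hε1 : ε ≤ 1) (hK₁ : 0 < K₁) (hMd0 : 0 ≤ Md)
    (hd : ∀ l i j a, T.Adj i j → Md ≤ #{b | v l (j, b) ∈ N (v l (i, a))})
    (hc : ∀ l i j a a', T.Adj i j → a ≠ a' →
      (#{b | v l (j, b) ∈ N (v l (i, a)) ∩ N (v l (i, a'))} : ℝ) ≤ Mc)
    (hA : ∀ u, ∀ w ∈ N u,
      K₁ ≤ #{l | T.Adj ((v l).symm u).1 ((v l).symm w).1} ∧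
      (#{l | T.Adj ((v l).symm u).1 ((v l).symm w).1} : ℝ) ≤ K₂)
    (hβd : Real.exp (-(ε ^ 2 * (Md / K₂) / 4)) ≤ β)
    (hβc : Real.exp (-(ε ^ 2 * (Mc / K₁ ^ 2) / 4)) ≤ β)
    (hβ : ((r * (t * (t * m)) + r * (t * (t * (m * m))) : ℕ) : ℝ) * β < 1) :
    ∃ c : Sym2 V → Fin r, ∀ l i j, T.Adj i j →
      (∀ a, (1 - ε) * (Md / K₂) ≤
        #{b | v l (j, b) ∈ N (v l (i, a)) ∧ c s(v l (i, a), v l (j, b)) = l}) ∧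
      ∀ a a', a ≠ a' →
        (#{b | (v l (j, b) ∈ N (v l (i, a)) ∧ c s(v l (i, a), v l (j, b)) = l) ∧
          v l (j, b) ∈ N (v l (i, a')) ∧ c s(v l (i, a'), v l (j, b)) = l} : ℝ)
        ≤ (1 + ε) * (Mc / K₁ ^ 2) := by
  let A : Sym2 V → Finset (Fin r) := fun z => {l | Sym2.map (fun u => ((v l).symm u).1) z ∈ T.edgeSet}
  -- The value `univ` for pairs never separated by adjacent classes is a dummy that keeps every
  -- choice set nonempty.
  let L : Sym2 V → Finset (Fin r) := fun z => if (A z).Nonempty then A z else univ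
  have : NeZero r := ⟨hr.ne'⟩
  have hL : ∀ z, (L z).Nonempty := by
    intro z
    by_cases h : (A z).Nonempty
    · simp [L, h]
    · simp [L, h]
  have hΩ : (choices L).Nonempty := choices_nonempty hL
  have hLA : ∀ u, ∀ w ∈ N u, ∀ l, T.Adj ((v l).symm u).1 ((v l).symm w).1 →
      l ∈ L s(u, w) ∧ K₁ ≤ #(L s(u, w)) ∧ (#(L s(u, w)) : ℝ) ≤ K₂ := by
    intro u w hw l hl
    have h1 : A s(u, w) = ({l | T.Adj ((v l).symm u).1 ((v l).symm w).1} : Finset (Fin r)) := by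
      ext l; simp [A]
    have h2 : l ∈ A s(u, w) := by rw [h1]; simpa using hl
    have h3 : L s(u, w) = A s(u, w) := if_pos ⟨l, h2⟩
    rw [h3]
    refine ⟨h2, ?_⟩
    rw [h1]
    exact hA u w hw
  have hβ0 : 0 ≤ β := (Real.exp_nonneg _).trans hβd
  have hprob : ∀ l i j a b, T.Adj i j → v l (j, b) ∈ N (v l (i, a)) →
      K₂⁻¹ ≤ prob (choices L) (fun c => c s(v l (i, a), v l (j, b)) = l) ∧
      prob (choices L) (fun c => c s(v l (i, a), v l (j, b)) = l) ≤ K₁⁻¹ := by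
    intro l i j a b hij hb
    obtain ⟨h1, h2, h3⟩ := hLA _ _ hb l (by simpa using hij)
    rw [prob_eq_inv L hL _ h1]
    have h4 : (0 : ℝ) < #(L s(v l (i, a), v l (j, b))) := by linarith
    exact ⟨inv_anti₀ h4 h3, inv_anti₀ hK₁ h2⟩
  have hside : ∀ (Q : Prop) (P : (Sym2 V → Fin r) → Prop),
      (Q → prob (choices L) P ≤ β) →
      prob (choices L) (fun ω => Q ∧ P ω) ≤ β := by
    intro Q P h
    by_cases hQ : Q
    · simpa [hQ] using h hQ
    · simpa [hQ, prob] using hβ0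
  let bad : (Fin r × Fin t × Fin t × Fin m) ⊕ (Fin r × Fin t × Fin t × Fin m × Fin m) →
      (Sym2 V → Fin r) → Prop := Sum.elim
    (fun ⟨l, i, j, a⟩ c => T.Adj i j ∧ (#{b ∈ ({b | v l (j, b) ∈ N (v l (i, a))} : Finset (Fin m)) |
      c s(v l (i, a), v l (j, b)) = l} : ℝ) < (1 - ε) * (Md / K₂))
    (fun ⟨l, i, j, a, a'⟩ c => (T.Adj i j ∧ a ≠ a') ∧ (1 + ε) * (Mc / K₁ ^ 2) <
      #{b ∈ ({b | v l (j, b) ∈ N (v l (i, a)) ∩ N (v l (i, a'))} : Finset (Fin m)) |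
        c s(v l (i, a), v l (j, b)) = l ∧ c s(v l (i, a'), v l (j, b)) = l})
  obtain ⟨c, -, hbad⟩ := exists_forall_not_of_sum_prob_lt (choices L) hΩ univ bad (b := β)
    (by
      rintro (⟨l, i, j, a⟩ | ⟨l, i, j, a, a'⟩) -
      · refine hside _ _ fun hij => le_trans ?_ hβd
        refine prob_lower_tail L hL _ _ (fun b => {s(v l (i, a), v l (j, b))})
          (fun b _ => dependsOn_coord _ fun x => x = l) ?_ hε0 hε1 ?_
        · intro b _ b' _ hbb
          simp [hbb, hij.ne]
        · calc Md / K₂ ≤ #{b | v l (j, b) ∈ N (v l (i, a))} * K₂⁻¹ := by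
                rw [div_eq_mul_inv]
                -- A neighbour provides `K₁ ≤ K₂`, hence the sign of `K₂`. With no neighbour the
                -- degree bound forces `Md = 0`.
                rcases (univ.filter fun b => v l (j, b) ∈ N (v l (i, a))).eq_empty_or_nonempty with
                  h | ⟨b, hb⟩
                · have := hd l i j a hij
                  rw [h] at this ⊢
                  have h0 : Md = 0 := le_antisymm (by simpa using this) hMd0
                  simp [h0]
                · have h1 := hA _ _ (mem_filter.1 hb).2
                  have h2 : 0 ≤ K₂ := by linarith
                  exact mul_le_mul_of_nonneg_right (hd l i j a hij) (inv_nonneg.2 h2)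
            _ ≤ _ := by
                rw [← nsmul_eq_mul, ← sum_const]
                exact sum_le_sum fun b hb => (hprob l i j a b hij (mem_filter.1 hb).2).1
      · refine hside _ _ fun ⟨hij, haa⟩ => le_trans ?_ hβc
        -- The edges from `a` and `a'` to `b` are different pairs, so they are assigned
        -- independently, and both get label `l` with probability at most `K₁⁻¹ ^ 2`.
        have hd2 : ∀ b, Disjoint ({s(v l (i, a), v l (j, b))} : Set (Sym2 V))
            {s(v l (i, a'), v l (j, b))} := by
          intro b
          simp [haa, hij.ne]
        refine prob_upper_tail L hL _ _
          (fun b => {s(v l (i, a), v l (j, b))} ∪ {s(v l (i, a'), v l (j, b))})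
          (fun b _ => dependsOn_and (dependsOn_coord _ fun x => x = l)
            (dependsOn_coord _ fun x => x = l)) ?_ hε0 hε1 ?_
        · intro b _ b' _ hbb
          simp [Ne.symm hbb, hij.ne]
        · calc _ ≤ ∑ b ∈ ({b | v l (j, b) ∈ N (v l (i, a)) ∩ N (v l (i, a'))} : Finset (Fin m)),
                K₁⁻¹ * K₁⁻¹ := sum_le_sum fun b hb => by
                rw [prob_and L (dependsOn_coord _ fun x => x = l)
                  (dependsOn_coord _ fun x => x = l) (hd2 b)]
                have hb' := mem_inter.1 (mem_filter.1 hb).2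
                exact mul_le_mul (hprob l i j a b hij hb'.1).2 (hprob l i j a' b hij hb'.2).2
                  (prob_nonneg _ _) (by positivity)
            _ ≤ Mc / K₁ ^ 2 := by
                rw [sum_const, nsmul_eq_mul, div_eq_mul_inv, sq, mul_inv]
                exact mul_le_mul_of_nonneg_right (hc l i j a a' hij haa) (by positivity))
    (by
      rw [card_univ]
      simp only [Fintype.card_sum, Fintype.card_prod, Fintype.card_fin]
      exact hβ)
  refine ⟨c, fun l i j hij => ⟨fun a => ?_, fun a a' haa => ?_⟩⟩
  · have h := not_lt.1 fun h => hbad (Sum.inl (l, i, j, a)) (mem_univ _) ⟨hij, h⟩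
    rw [filter_filter] at h
    exact h
  · have h := not_lt.1 fun h => hbad (Sum.inr (l, i, j, a, a')) (mem_univ _) ⟨⟨hij, haa⟩, h⟩
    rw [filter_filter] at h
    refine le_trans (Nat.cast_le.2 (card_le_card fun b => ?_)) h
    simp only [mem_filter, mem_univ, true_and, mem_inter]
    tauto

end RandomPartition

/-! ### Edge counts for the tree and the graph -/

lemma card_ordered_pairs {t : ℕ} {T : SimpleGraph (Fin t)} (hT : T.IsTree) :
    (#{p : Fin t × Fin t | T.Adj p.1 p.2} : ℝ) = 2 * ((t : ℝ) - 1) := by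
  have h1 : #{p : Fin t × Fin t | T.Adj p.1 p.2}
      = #{p : Fin t × Fin t | T.Adj p.1 p.2 ∧ p.1 < p.2}
        + #{p : Fin t × Fin t | T.Adj p.1 p.2 ∧ p.2 < p.1} := by
    rw [← card_union_of_disjoint]
    · congr 1
      ext p
      simp only [mem_filter, mem_univ, true_and, mem_union]
      constructor
      · intro h
        rcases lt_or_gt_of_ne h.ne with h' | h'
        · exact Or.inl ⟨h, h'⟩
        · exact Or.inr ⟨h, h'⟩
      · rintro (h | h) <;> exact h.1
    · exact disjoint_filter.2 fun p _ h h' => h.2.asymm h'.2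
  have h2 : #{p : Fin t × Fin t | T.Adj p.1 p.2 ∧ p.2 < p.1}
      = #{p : Fin t × Fin t | T.Adj p.1 p.2 ∧ p.1 < p.2} := by
    refine card_bij' (fun p _ => p.swap) (fun p _ => p.swap) ?_ ?_ ?_ ?_ <;>
      simp +contextual [SimpleGraph.adj_comm]
  have h3 := card_ordered_edges hT
  have h4 : ((#{p : Fin t × Fin t | T.Adj p.1 p.2 ∧ p.1 < p.2} : ℕ) : ℝ) = (t : ℝ) - 1 := by
    rw [eq_sub_iff_add_eq]; exact_mod_cast h3
  rw [h1, h2]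
  push_cast
  linarith

section Graph

variable {V : Type*} [Fintype V] {G : SimpleGraph V} {ε p : ℝ}

lemma ncard_neighborSet (u : V) : (G.neighborSet u).ncard = #{w | G.Adj u w} := by
  rw [← Set.ncard_coe_finset]
  congr 1
  ext w
  simp

lemma ncard_commonNeighbors (u v : V) :
    (G.commonNeighbors u v).ncard = #{w | G.Adj u w ∧ G.Adj v w} := by
  rw [← Set.ncard_coe_finset]
  congr 1
  ext w
  simp [SimpleGraph.mem_commonNeighbors]

/-- A pseudorandom graph does not have more edges than expected. -/
lemma ncard_edgeSet_le (hG : IsPseudoRegular G ε p) (hε : 0 ≤ ε) (hp : 0 < p)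
    (hbig : 1 ≤ ε * Fintype.card V * p) :
    2 * (G.edgeSet.ncard : ℝ) * (1 - 2 * ε) ≤ (1 + ε) * (Fintype.card V : ℝ) ^ 2 * p := by
  have h1 : ∀ u, (#{w | G.Adj u w} : ℝ) * (1 - 2 * ε) ≤ (1 + ε) * Fintype.card V * p := by
    refine card_mul_le_of_codegree_le hε hp hbig (fun b => ?_) (fun a a' haa => ?_)
    · simp_rw [SimpleGraph.adj_comm _ _ b]
      rw [← ncard_neighborSet]
      exact hG.le_degree b
    · rw [← ncard_commonNeighbors]
      exact hG.codegree_le a a' haa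
  have h2 : ∑ u, (#{w | G.Adj u w} : ℝ) = 2 * G.edgeSet.ncard := by
    have h := G.sum_degrees_eq_twice_card_edges
    rw [Set.ncard_eq_toFinset_card', ← SimpleGraph.edgeFinset]
    rw [← Nat.cast_sum]
    rw [← Nat.cast_two, ← Nat.cast_mul, ← h]
    congr 1
    refine sum_congr rfl fun u _ => ?_
    rw [← SimpleGraph.card_neighborFinset_eq_degree]
    congr 1
    ext w
    simp
  rw [← h2, sum_mul]
  refine (sum_le_sum fun u _ => h1 u).trans_eq ?_
  rw [sum_const, nsmul_eq_mul, card_univ]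
  ring

end Graph

/-- The edges leaving the groups of a partition into groups of size `t`. -/
lemma card_outside_group {V : Type*} [Fintype V] (G : SimpleGraph V) {m t : ℕ}
    (e : V ≃ Fin m × Fin t) (u : V) :
    (#{w | G.Adj u w} : ℝ) - t ≤ #{w | G.Adj u w ∧ (e u).1 ≠ (e w).1} := by
  have h1 : #{w | (e u).1 = (e w).1} ≤ t := by
    calc _ ≤ #(univ : Finset (Fin t)) := by
          refine card_le_card_of_injOn (fun w => (e w).2) (fun _ _ => mem_univ _) ?_
          intro w hw w' hw' h
          simp only [coe_filter, mem_univ, true_and, Set.mem_ofPred_eq] at hw hw'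
          exact e.injective (Prod.ext (hw.symm.trans hw') h)
      _ = t := by simp
  have h2 : #{w | G.Adj u w} ≤ #{w | G.Adj u w ∧ (e u).1 ≠ (e w).1} + #{w | (e u).1 = (e w).1} := by
    refine le_trans (card_le_card fun w hw => ?_) (card_union_le _ _)
    simp only [mem_filter, mem_univ, true_and, mem_union] at hw ⊢
    tauto
  have h3 : #{w | G.Adj u w} ≤ #{w | G.Adj u w ∧ (e u).1 ≠ (e w).1} + t := by omega
  have h4 : (#{w | G.Adj u w} : ℝ) ≤ #{w | G.Adj u w ∧ (e u).1 ≠ (e w).1} + t := by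
    exact_mod_cast h3
  linarith

/-! ### Assembly and choice of parameters -/

set_option maxHeartbeats 1000000 in
/-- Packing of tree factors in pseudorandom graphs, with explicit parameters: `r` equipartitions,
`K` of which separate a typical pair of vertices by adjacent classes. -/
theorem hasFactorPacking_of_parameters {V : Type*} [Fintype V] {G : SimpleGraph V} {m t r : ℕ}
    (ht : 2 ≤ t) (e : V ≃ Fin m × Fin t) {T : SimpleGraph (Fin t)} (hT : T.IsTree)
    {ε p K β δ' : ℝ} (hG : IsPseudoRegular G ε p) (hr : 0 < r) (hε : 0 < ε) (hε' : ε ≤ 1 / 4096)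
    (hp : 0 < p) (hK : K = r * (2 * ((t : ℝ) - 1) / (t : ℝ) ^ 2)) (hmp : 1 ≤ ε * m * p)
    (hmq : 1 ≤ ε * m * (p / K))
    (hβ₁ : Real.exp (-(ε ^ 2 * ((1 - 2 * ε) * m * p) / 4)) ≤ β)
    (hβ₂ : Real.exp (-(ε ^ 2 * ((1 + ε) * m * p ^ 2) / 4)) ≤ β)
    (hβ₃ : Real.exp (-(ε ^ 2 * K / 4)) ≤ β)
    (hβ₄ : Real.exp (-(ε ^ 2 * ((1 - ε) * ((1 - 2 * ε) * m * p) / ((1 + ε) * K)) / 4)) ≤ β)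
    (hβ₅ : Real.exp (-(ε ^ 2 * ((1 + ε) * ((1 + ε) * m * p ^ 2) / ((1 - ε) * K) ^ 2) / 4)) ≤ β)
    (hβ : ((Fintype.card V * (r * t) + Fintype.card V * (Fintype.card V * (r * t))
      + Fintype.card V * Fintype.card V + Fintype.card V * Fintype.card V : ℕ) : ℝ) * β < 1)
    (hβ' : ((r * (t * (t * m)) + r * (t * (t * (m * m))) : ℕ) : ℝ) * β < 1)
    (hδ' : 16 * √ε + 5 * ε ≤ δ') (hδ'1 : δ' ≤ 1) :
    HasFactorPacking T G δ' := by
  have : NeZero t := ⟨by omega⟩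
  have ht' : (2 : ℝ) ≤ t := by exact_mod_cast ht
  have hr' : (0 : ℝ) < r := by exact_mod_cast hr
  have hK0 : 0 < K := by
    rw [hK]
    have : (0 : ℝ) < t - 1 := by linarith
    positivity
  have hV : (Fintype.card V : ℝ) = m * t := by
    rw [Fintype.card_congr e]; simp
  have hm0 : (0 : ℝ) ≤ m := by positivity
  -- Dropping the neighbours in the own group costs at most `t ≤ ε * m * t * p`, turning `1 - ε`
  -- into `1 - 2 * ε`.
  set N : V → Finset V := fun u => {w | G.Adj u w ∧ (e u).1 ≠ (e w).1} with hNdef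
  have hN1 : ∀ u, (1 - 2 * ε) * m * p ≤ #(N u) / t := by
    intro u
    rw [le_div_iff₀ (by linarith)]
    have h1 := card_outside_group G e u
    have h2 := hG.le_degree u
    rw [ncard_neighborSet, hV] at h2
    have h3 : (t : ℝ) * 1 ≤ t * (ε * m * p) := mul_le_mul_of_nonneg_left hmp (by linarith)
    linarith
  have hN2 : ∀ u w, u ≠ w → (#(N u ∩ N w) : ℝ) / t ≤ (1 + ε) * m * p ^ 2 := by
    intro u w huw
    rw [div_le_iff₀ (by linarith)]
    have h1 := hG.codegree_le u w huw
    rw [ncard_commonNeighbors, hV] at h1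
    have h2 : (#(N u ∩ N w) : ℝ) ≤ #{z | G.Adj u z ∧ G.Adj w z} := by
      refine Nat.cast_le.2 (card_le_card fun z hz => ?_)
      simp only [hNdef, mem_inter, mem_filter, mem_univ, true_and] at hz ⊢
      exact ⟨hz.1.1, hz.2.1⟩
    linarith
  obtain ⟨s, hs1, hs2, hs3⟩ := exists_shifts e T N (r := r) (K := K) (β := β) hε.le (by linarith)
    (by rw [card_ordered_pairs hT, hK]) hN1 hN2 hβ₁ hβ₂ hβ₃ hβ
  have hMd : 0 ≤ (1 - 2 * ε) * m * p := mul_nonneg (mul_nonneg (by linarith) hm0) hp.le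
  obtain ⟨c, hc⟩ := exists_edge_assignment T (fun l => shiftEquiv e (s l)) N
    (Md := (1 - ε) * ((1 - 2 * ε) * m * p)) (Mc := (1 + ε) * ((1 + ε) * m * p ^ 2))
    (K₁ := (1 - ε) * K) (K₂ := (1 + ε) * K) (β := β) hr hε.le (by linarith)
    (mul_pos (by linarith) hK0) (mul_nonneg (by linarith) hMd)
    (fun l i j a _ => hs1 _ l j) (fun l i j a a' _ haa => hs2 _ _ l j (by simpa using haa))
    (fun u w hw => hs3 u w (mem_filter.1 hw).2.2) hβ₄ hβ₅ hβ'
  set q := p / K with hq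
  have hq0 : 0 < q := by positivity
  have hpq : p = q * K := by rw [hq]; field_simp
  have hsq : √ε ^ 2 = ε := Real.sq_sqrt hε.le
  have hsq1 : √ε ≤ 1 / 64 := by
    rw [Real.sqrt_le_left (by norm_num)]; norm_num; linarith
  have hmq0 : 0 ≤ m * q := by positivity
  have hlow : (1 - 10 * ε) * m * q ≤ (1 - ε) * ((1 - ε) * ((1 - 2 * ε) * m * p) / ((1 + ε) * K)) := by
    have h1 : (1 - ε) * ((1 - ε) * ((1 - 2 * ε) * m * p) / ((1 + ε) * K))
        = (1 - ε) ^ 2 * (1 - 2 * ε) / (1 + ε) * (m * q) := by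
      rw [hpq]; field_simp
    have h2 : 1 - 10 * ε ≤ (1 - ε) ^ 2 * (1 - 2 * ε) / (1 + ε) := by
      rw [le_div_iff₀ (by linarith)]
      nlinarith [sq_nonneg ε]
    rw [h1, mul_assoc]
    exact mul_le_mul_of_nonneg_right h2 hmq0
  have hup : (1 + ε) * ((1 + ε) * ((1 + ε) * m * p ^ 2) / ((1 - ε) * K) ^ 2)
      ≤ (1 + 10 * ε) * m * q ^ 2 := by
    have h0 : 0 < 1 - ε := by linarith
    have h1 : (1 + ε) * ((1 + ε) * ((1 + ε) * m * p ^ 2) / ((1 - ε) * K) ^ 2)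
        = (1 + ε) ^ 3 / (1 - ε) ^ 2 * (m * q ^ 2) := by
      rw [hpq]; field_simp
    have h2 : (1 + ε) ^ 3 / (1 - ε) ^ 2 ≤ 1 + 10 * ε := by
      rw [div_le_iff₀ (by positivity)]
      nlinarith [mul_nonneg hε.le hε.le, mul_nonneg (mul_nonneg hε.le hε.le) hε.le]
    rw [h1, mul_assoc]
    exact mul_le_mul_of_nonneg_right h2 (by positivity)
  set k : ℕ := ⌊(1 - 16 * √ε) * m * q⌋₊ with hkdef
  have hk0 : 0 ≤ (1 - 16 * √ε) * m * q := by
    rw [mul_assoc]; exact mul_nonneg (by linarith) hmq0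
  have hk1 : (k : ℝ) ≤ (1 - 16 * √ε) * m * q := Nat.floor_le hk0
  have hk2 : (1 - 16 * √ε) * m * q - 1 ≤ k := by linarith [Nat.lt_floor_add_one ((1 - 16 * √ε) * m * q)]
  refine hasFactorPacking_of_matchings hT G (r := r) (k := k) (fun l => shiftEquiv e (s l)) c ?_ ?_
  · intro l i j hij _
    -- The requirement `24 * η ≤ δ ^ 2` becomes `240 * ε ≤ 256 * ε`, and `δ ≤ 1 / 4` is `√ε ≤ 1 /
    -- 64`, that is, `ε ≤ 1 / 4096`.
    obtain ⟨σ, hσ, hd⟩ := exists_disjoint_perms (A := Fin m) (η := 10 * ε) (q := q)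
      (δ := 16 * √ε) (k := k)
      (R := fun a b => shiftEquiv e (s l) (j, b) ∈ N (shiftEquiv e (s l) (i, a)) ∧
        c s(shiftEquiv e (s l) (i, a), shiftEquiv e (s l) (j, b)) = l)
      (by linarith) hq0 (by linarith [Real.sqrt_nonneg ε]) (by linarith) (by linarith [mul_pow 16 (√ε) 2])
      (by rw [Fintype.card_fin]; linarith)
      (fun a => by
        rw [Fintype.card_fin]
        exact (hlow.trans ((hc l i j hij).1 a)).trans_eq (by congr!))
      (fun b => by
        rw [Fintype.card_fin]
        refine (hlow.trans ((hc l j i hij.symm).1 b)).trans_eq ?_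
        congr 2
        ext a
        simp only [hNdef, mem_filter, mem_univ, true_and]
        rw [Sym2.eq_swap, G.adj_comm, ne_comm])
      (fun a a' haa => by
        rw [Fintype.card_fin]
        exact (le_of_eq (by congr!)).trans (((hc l i j hij).2 a a' haa).trans hup))
      (by rw [Fintype.card_fin]; exact hk1)
    exact ⟨σ, fun x a => ⟨(mem_filter.1 (hσ x a).1).2.1, (hσ x a).2⟩, hd⟩
  · have h1 := ncard_edgeSet_le hG hε.le hp (by
      rw [hV]
      have := mul_le_mul_of_nonneg_right hmp (show (0 : ℝ) ≤ t by positivity)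
      linarith)
    rw [hV] at h1
    -- This is where the value of `K` enters: matchings of full size would cover exactly `n ^ 2 * p
    -- / 2` edges.
    have h2 : (r : ℝ) * (t - 1) * m * (m * q) = (m * t) ^ 2 * p / 2 := by
      rw [hq, hK]
      have : (t : ℝ) - 1 ≠ 0 := by linarith
      field_simp
    have h3 : (1 - 16 * √ε - ε) * (m * q) ≤ k := by linarith
    have h4 : (r : ℝ) * (t - 1) * m * ((1 - 16 * √ε - ε) * (m * q)) ≤ r * (t - 1) * m * k :=
      mul_le_mul_of_nonneg_left h3 (mul_nonneg (mul_nonneg hr'.le (by linarith)) hm0)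
    have h5 : (1 - δ') * (1 + ε) ≤ (1 - 16 * √ε - ε) * (1 - 2 * ε) := by
      have h0 := Real.sqrt_nonneg ε
      have h01 : 0 ≤ δ' * ε := mul_nonneg (by linarith) hε.le
      have h02 : 0 ≤ √ε * ε := by positivity
      have h03 : 0 ≤ ε * ε := by positivity
      linarith
    have h6 : (1 - δ') * (2 * (G.edgeSet.ncard : ℝ) * (1 - 2 * ε))
        ≤ (1 - δ') * ((1 + ε) * (m * t) ^ 2 * p) := mul_le_mul_of_nonneg_left h1 (by linarith)
    have h7 : (1 - δ') * (1 + ε) * ((m * t) ^ 2 * p)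
        ≤ (1 - 16 * √ε - ε) * (1 - 2 * ε) * ((m * t) ^ 2 * p) :=
      mul_le_mul_of_nonneg_right h5 (by positivity)
    refine le_of_mul_le_mul_right (a := 2 * (1 - 2 * ε)) ?_ (by linarith)
    have h8 := mul_le_mul_of_nonneg_right h4 (show 0 ≤ 2 * (1 - 2 * ε) by linarith)
    have h9 : (r : ℝ) * (t - 1) * m * ((1 - 16 * √ε - ε) * (m * q)) * (2 * (1 - 2 * ε))
        = (1 - 16 * √ε - ε) * (1 - 2 * ε) * ((m * t) ^ 2 * p) := by
      linear_combination (1 - 16 * √ε - ε) * (2 * (1 - 2 * ε)) * h2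
    linarith

/-- With `ε = y ^ 6` the claim is `16 * y ^ 3 + 5 * y ^ 6 ≤ 2 * y ^ 2`, which follows from `21 * y ≤
2`; the bound `y ≤ 1 / 11` is enough. -/
lemma error_terms_le {ε : ℝ} (hε : 0 < ε) (hε' : ε ≤ 1 / 11 ^ 6) :
    16 * √ε + 5 * ε ≤ 2 * ε ^ (1 / 3 : ℝ) ∧ 2 * ε ^ (1 / 3 : ℝ) ≤ 1 := by
  obtain ⟨y, hy0, rfl⟩ : ∃ y : ℝ, 0 < y ∧ ε = y ^ 6 := by
    refine ⟨ε ^ (1 / 6 : ℝ), by positivity, ?_⟩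
    rw [← Real.rpow_natCast, ← Real.rpow_mul hε.le]
    norm_num
  have hy : y ≤ 1 / 11 := by
    rw [← one_div_pow] at hε'
    exact (pow_le_pow_iff_left₀ hy0.le (by norm_num) (by norm_num)).1 hε'
  have h1 : √(y ^ 6) = y ^ 3 := by
    rw [show y ^ 6 = (y ^ 3) ^ 2 by ring]
    exact Real.sqrt_sq (by positivity)
  have h2 : (y ^ 6) ^ (1 / 3 : ℝ) = y ^ 2 := by
    rw [← Real.rpow_natCast, ← Real.rpow_natCast, ← Real.rpow_mul hy0.le]
    norm_num
  rw [h1, h2]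
  have h3 : y ^ 2 * y ≤ y ^ 2 * (1 / 11) := mul_le_mul_of_nonneg_left hy (by positivity)
  have h4 : y ^ 3 * y ^ 3 ≤ y ^ 3 * 1 :=
    mul_le_mul_of_nonneg_left (pow_le_one₀ hy0.le (by linarith)) (by positivity)
  constructor
  · nlinarith
  · nlinarith

/-- No upper bound on `p` is assumed, but degrees are at most the number of vertices. This allows
powers of `p` to be traded for constants. -/
lemma le_two_of_isPseudoRegular {V : Type*} [Fintype V] [Nonempty V] {G : SimpleGraph V} {ε p : ℝ}
    (hG : IsPseudoRegular G ε p) (hε : ε ≤ 1 / 2) (hp : 0 < p) : p ≤ 2 := by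
  obtain ⟨u⟩ := ‹Nonempty V›
  have h1 := hG.le_degree u
  have h2 : ((G.neighborSet u).ncard : ℝ) ≤ Fintype.card V := by
    rw [ncard_neighborSet]
    exact_mod_cast card_le_univ _
  have h3 : (0 : ℝ) < Fintype.card V := by
    exact_mod_cast Fintype.card_pos_iff.2 ⟨u⟩
  have h4 : Fintype.card V * ((1 - ε) * p) ≤ Fintype.card V * 1 := by linarith
  have h5 := le_of_mul_le_mul_left h4 h3
  nlinarith

lemma count_lt_pow_five {n r t : ℝ} (hn : 3 ≤ n) (ht : 0 ≤ t) (hrn : r ≤ n)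
    (htn : t ≤ n) :
    n * (r * t) + n * (n * (r * t)) + n * n + n * n < n ^ 5 ∧
      r * t * n + r * (n * n) < n ^ 5 := by
  have hn0 : 0 < n := by linarith
  have h1 : r * t ≤ n * n := mul_le_mul hrn htn ht hn0.le
  have h2 : n * (r * t) ≤ n * (n * n) := mul_le_mul_of_nonneg_left h1 hn0.le
  have h3 : n * (n * (r * t)) ≤ n * (n * (n * n)) := mul_le_mul_of_nonneg_left h2 hn0.le
  have h4 : r * (n * n) ≤ n * (n * n) := mul_le_mul_of_nonneg_right hrn (by positivity)
  have h5 : 3 * n ^ 2 ≤ n * n ^ 2 := mul_le_mul_of_nonneg_right hn (by positivity)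
  have h6 : 3 * n ^ 3 ≤ n * n ^ 3 := mul_le_mul_of_nonneg_right hn (by positivity)
  have h7 : 3 * n ^ 4 ≤ n * n ^ 4 := mul_le_mul_of_nonneg_right hn (by positivity)
  have h8 : 0 < n ^ 2 := by positivity
  constructor <;> linarith

/-- Packing of tree factors in pseudorandom graphs, in quantitative form. -/
theorem hasFactorPacking_of_log_le {V : Type*} [Fintype V] {G : SimpleGraph V} {m t : ℕ}
    (ht : 2 ≤ t) (e : V ≃ Fin m × Fin t) {T : SimpleGraph (Fin t)} (hT : T.IsTree) {ε p x : ℝ}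
    (hG : IsPseudoRegular G ε p) (hε : 0 < ε) (hε' : ε ≤ 1 / 11 ^ 6) (hp : 0 < p)
    (hxV : Real.exp x = Fintype.card V) (hx : 2 ≤ x)
    (hlarge : 400000 * (t : ℝ) ^ 2 * x ^ 3 ≤ ε ^ 6 * (Fintype.card V : ℝ) * p ^ 4) :
    HasFactorPacking T G (2 * ε ^ (1 / 3 : ℝ)) := by
  have hε1 : ε ≤ 1 / 4096 := hε'.trans (by norm_num)
  have ht' : (2 : ℝ) ≤ t := by exact_mod_cast ht
  have hV : (Fintype.card V : ℝ) = m * t := by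
    rw [Fintype.card_congr e]; simp
  have hn3 : (3 : ℝ) ≤ Fintype.card V := by rw [← hxV]; linarith [Real.add_one_le_exp x]
  have : Nonempty V := by
    rw [← Fintype.card_pos_iff]
    have : (0 : ℝ) < Fintype.card V := by linarith
    exact_mod_cast this
  have hp2 := le_two_of_isPseudoRegular hG (by linarith) hp
  have hm : (1 : ℝ) ≤ m := by
    have : m ≠ 0 := by
      rintro rfl
      simp at hV
    exact_mod_cast Nat.one_le_iff_ne_zero.2 this
  have hp4 : p ^ 2 ≤ 4 := by linarith [pow_le_pow_left₀ hp.le hp2 2]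
  have hε0 : 0 ≤ ε * ε := by positivity
  have F0 : 100000 * t * x ^ 3 ≤ ε ^ 6 * m * p ^ 2 := by
    have h2 : ε ^ 6 * (m * t) * p ^ 2 * p ^ 2 ≤ ε ^ 6 * (m * t) * p ^ 2 * 4 :=
      mul_le_mul_of_nonneg_left hp4 (by positivity)
    rw [hV] at hlarge
    have h3 : (4 * t) * (100000 * t * x ^ 3) ≤ (4 * t) * (ε ^ 6 * m * p ^ 2) := by linarith
    exact le_of_mul_le_mul_left h3 (by positivity)
  have hx3 : x ≤ x ^ 3 := le_self_pow₀ (by linarith) (by norm_num)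
  have hx23 : x ^ 2 ≤ x ^ 3 := pow_le_pow_right₀ (by linarith) (by norm_num)
  have F1 : 100000 * x ^ 3 ≤ ε ^ 6 * m * p ^ 2 := by
    refine le_trans ?_ F0
    have : 1 * x ^ 3 ≤ t * x ^ 3 := mul_le_mul_of_nonneg_right (by linarith) (by positivity)
    linarith
  have F2 : 50000 * x ^ 3 ≤ ε ^ 4 * m * p := by
    have h1 : ε ^ 6 * m * p ^ 2 ≤ ε ^ 4 * m * p * 2 := by
      have : ε ^ 6 * m * p ^ 2 = ε ^ 4 * m * p * (ε ^ 2 * p) := by ring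
      rw [this]
      refine mul_le_mul_of_nonneg_left ?_ (by positivity)
      linarith [mul_le_mul_of_nonneg_right (pow_le_one₀ (n := 2) hε.le (by linarith)) hp.le]
    linarith
  have F3 : 50000 * x ^ 3 ≤ ε ^ 3 * m * p := F2.trans (by
    gcongr ?_ * _ * _
    exact pow_le_pow_of_le_one hε.le (by linarith) (by norm_num))
  have F4 : 50000 * x ^ 3 ≤ ε ^ 2 * m * p := F2.trans (by
    gcongr ?_ * _ * _
    exact pow_le_pow_of_le_one hε.le (by linarith) (by norm_num))
  have F5 : 50000 * x ^ 3 ≤ ε * m * p := F2.trans (by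
    gcongr ?_ * _ * _
    exact pow_le_of_le_one hε.le (by linarith) (by norm_num))
  have F6 : 100000 * x ^ 3 ≤ ε ^ 2 * m * p ^ 2 := F1.trans (by
    gcongr ?_ * _ * _
    exact pow_le_pow_of_le_one hε.le (by linarith) (by norm_num))
  have F7 : 21 * x * t ≤ ε ^ 2 * m := by
    have h1 : ε ^ 6 * m * p ^ 2 ≤ ε ^ 2 * m * 4 := by
      have : ε ^ 6 * m * p ^ 2 ≤ ε ^ 2 * m * p ^ 2 := by
        gcongr ?_ * _ * _
        exact pow_le_pow_of_le_one hε.le (by linarith) (by norm_num)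
      refine this.trans ?_
      exact mul_le_mul_of_nonneg_left hp4 (by positivity)
    have h2 := mul_le_mul_of_nonneg_left hx3 (show (0 : ℝ) ≤ t by linarith)
    have h3 : 0 ≤ (t : ℝ) * x := by positivity
    linarith
  set κ : ℝ := 2 * ((t : ℝ) - 1) / (t : ℝ) ^ 2 with hκ
  have hκ0 : 0 < κ := by
    have : (0 : ℝ) < t - 1 := by linarith
    positivity
  have hκ1 : κ ≤ 1 := by
    rw [hκ, div_le_one (by positivity)]
    nlinarith [sq_nonneg ((t : ℝ) - 1)]
  have hκt : 1 ≤ κ * (t : ℝ) ^ 2 := by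
    rw [hκ, div_mul_cancel₀ _ (by positivity)]
    linarith
  -- The least `r` for which `ε ^ 2 * K ≥ 20 * x`, where `x = log n`: the concentration of the
  -- number of partitions separating a pair then fails with probability at most `exp (-(5 * x))`.
  set r : ℕ := ⌈20 * x / (ε ^ 2 * κ)⌉₊ with hr
  have hr0 : 0 < r := Nat.ceil_pos.2 (by positivity)
  have hr1 : 20 * x / (ε ^ 2 * κ) ≤ r := Nat.le_ceil _
  have hr2 : (r : ℝ) < 20 * x / (ε ^ 2 * κ) + 1 := Nat.ceil_lt_add_one (by positivity)
  obtain ⟨K, hK⟩ : ∃ K : ℝ, K = r * κ := ⟨_, rfl⟩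
  have hK0 : 0 < K := by rw [hK]; positivity
  have hK1 : 20 * x ≤ ε ^ 2 * K := by
    rw [div_le_iff₀ (by positivity)] at hr1
    rw [hK]; linarith
  have hK2 : ε ^ 2 * K ≤ 21 * x := by
    have h1 : (r : ℝ) * (ε ^ 2 * κ) ≤ (20 * x / (ε ^ 2 * κ) + 1) * (ε ^ 2 * κ) :=
      mul_le_mul_of_nonneg_right hr2.le (by positivity)
    rw [add_mul, div_mul_cancel₀ _ (by positivity)] at h1
    have h2 : ε ^ 2 * κ ≤ 1 := mul_le_one₀ (pow_le_one₀ hε.le (by linarith)) hκ0.le hκ1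
    rw [hK]; linarith
  have hrV : (r : ℝ) ≤ Fintype.card V := by
    have h1 : (r : ℝ) * 1 ≤ r * (κ * (t : ℝ) ^ 2) := mul_le_mul_of_nonneg_left hκt (by positivity)
    have h2 : ε ^ 2 * (K * t) ≤ ε ^ 2 * m := by
      have := mul_le_mul_of_nonneg_right hK2 (show (0 : ℝ) ≤ t by linarith)
      linarith
    have h3 := le_of_mul_le_mul_left h2 (by positivity)
    have h4 := mul_le_mul_of_nonneg_right h3 (show (0 : ℝ) ≤ t by linarith)
    rw [hV]
    rw [hK] at h4
    linarith
  have htV : (t : ℝ) ≤ Fintype.card V := by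
    rw [hV]; exact le_mul_of_one_le_left (by linarith) hm
  have hmV : (m : ℝ) ≤ Fintype.card V := by
    rw [hV]; exact le_mul_of_one_le_right (by linarith) (by linarith)
  -- Each bad event has probability at most `n ^ (-5)`, and each of the two union bounds involves
  -- fewer than `n ^ 5` events.
  have hβ : (Fintype.card V : ℝ) ^ 5 * Real.exp (-(5 * x)) = 1 := by
    rw [← hxV, ← Real.exp_nat_mul, ← Real.exp_add]
    norm_num
  have hexp : ∀ A, 20 * x ≤ A → Real.exp (-(A / 4)) ≤ Real.exp (-(5 * x)) := by
    intro A hA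
    rw [Real.exp_le_exp]
    linarith
  obtain ⟨hδ, hδ1⟩ := error_terms_le hε hε'
  refine hasFactorPacking_of_parameters (β := Real.exp (-(5 * x))) (K := K) (r := r) ht e hT hG hr0 hε hε1 hp hK
    (by linarith) ?_ (hexp _ ?_) (hexp _ ?_) (hexp _ hK1) (hexp _ ?_) (hexp _ ?_) ?_ ?_ hδ hδ1
  · rw [← mul_div_assoc, le_div_iff₀ hK0, one_mul]
    have h1 : ε ^ 2 * K ≤ ε ^ 2 * (ε * m * p) := by linarith
    exact le_of_mul_le_mul_left h1 (by positivity)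
  · have h1 : ε ^ 2 * m * p * (2 * ε) ≤ ε ^ 2 * m * p * (1 / 2) :=
      mul_le_mul_of_nonneg_left (by linarith) (by positivity)
    linarith
  · have h1 : 0 ≤ ε * (ε ^ 2 * m * p ^ 2) := by positivity
    linarith
  · rw [← mul_div_assoc, le_div_iff₀ (by positivity)]
    refine le_of_mul_le_mul_left (a := ε ^ 2) ?_ (by positivity)
    have h1 : ε ^ 2 * (20 * x * ((1 + ε) * K)) ≤ 2 * (20 * x * (21 * x)) := by
      calc _ = (20 * x * (ε ^ 2 * K)) * (1 + ε) := by ring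
        _ ≤ (20 * x * (21 * x)) * 2 := by gcongr; linarith
        _ = _ := by ring
    have h2 : ε ^ 4 * m * p * (1 / 2) ≤ ε ^ 4 * m * p * ((1 - ε) * (1 - 2 * ε)) :=
      mul_le_mul_of_nonneg_left (by linarith) (by positivity)
    linarith
  -- The most demanding bound: the thinned codegrees have mean about `m * p ^ 2 / K ^ 2` with `K` up
  -- to `21 * x / ε ^ 2`, so `ε ^ 6 * m * p ^ 2` must exceed a multiple of `x ^ 3`. This accounts
  -- for the sixth power of `ε` and the cube of the logarithm.
  · have h0 : 0 < 1 - ε := by linarith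
    rw [← mul_div_assoc, le_div_iff₀ (by positivity)]
    refine le_of_mul_le_mul_left (a := ε ^ 4) ?_ (by positivity)
    have h1 : ε ^ 4 * (20 * x * ((1 - ε) * K) ^ 2) ≤ 20 * x * (21 * x) ^ 2 := by
      calc _ = 20 * x * ((1 - ε) * (ε ^ 2 * K)) ^ 2 := by ring
        _ ≤ 20 * x * (1 * (21 * x)) ^ 2 := by gcongr; linarith
        _ = _ := by ring
    have h2 : ε ^ 6 * m * p ^ 2 * 1 ≤ ε ^ 6 * m * p ^ 2 * ((1 + ε) * (1 + ε)) :=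
      mul_le_mul_of_nonneg_left (by linarith) (by positivity)
    have h3 : 0 ≤ x ^ 3 := by positivity
    linarith
  · rw [← hβ]
    refine mul_lt_mul_of_pos_right ?_ (Real.exp_pos _)
    push_cast
    exact (count_lt_pow_five hn3 (by linarith) hrV htV).1
  · rw [← hβ]
    refine mul_lt_mul_of_pos_right ?_ (Real.exp_pos _)
    push_cast
    have e1 : (r : ℝ) * (t * (t * m)) + r * (t * (t * (m * m)))
        = r * t * (m * t) + r * ((m * t) * (m * t)) := by ring
    rw [e1, ← hV]
    exact (count_lt_pow_five hn3 (by linarith) hrV htV).2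

end TreeFactor

theorem theorem1 :
    ∃ ε₀ : ℝ, 0 < ε₀ ∧
      ∀ (t : ℕ) (T : SimpleGraph (Fin t)), 2 ≤ t → T.IsTree →
        ∀ ε p : ℕ → ℝ,
          (∀ n, 0 < ε n ∧ ε n ≤ ε₀) →
          (∀ n, 0 < p n) →
          Filter.Tendsto
            (fun n : ℕ => ε n ^ 6 * (n : ℝ) * p n ^ 4 / Real.log (n : ℝ) ^ 3)
            Filter.atTop Filter.atTop →
          ∀ᶠ n : ℕ in Filter.atTop, t ∣ n →
            ∀ G : SimpleGraph (Fin n), IsPseudoRegular G (ε n) (p n) →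
              HasFactorPacking T G (2 * ε n ^ (1 / 3 : ℝ)) := by
  refine ⟨1 / 11 ^ 6, by norm_num, fun t T ht hT ε p hε hp hlim => ?_⟩
  have hlog : Filter.Tendsto (fun n : ℕ => Real.log n) Filter.atTop Filter.atTop :=
    Real.tendsto_log_atTop.comp tendsto_natCast_atTop_atTop
  filter_upwards [hlim.eventually_ge_atTop (400000 * (t : ℝ) ^ 2), hlog.eventually_ge_atTop 2,
    Filter.eventually_gt_atTop 0] with n h1 h2 h3
  rintro ⟨m, rfl⟩ G hG
  have e : Fin (t * m) ≃ Fin m × Fin t := (finCongr (mul_comm t m)).trans finProdFinEquiv.symm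
  refine TreeFactor.hasFactorPacking_of_log_le ht e hT hG (hε _).1 (hε _).2 (hp _)
    (x := Real.log ((t * m : ℕ) : ℝ)) ?_ h2 ?_
  · rw [Fintype.card_fin, Real.exp_log (by exact_mod_cast h3)]
  · rw [Fintype.card_fin]
    exact (le_div_iff₀ (by positivity)).1 h1
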